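/- Let $p$ be a prime and let $(K,\mathcal{O},k)$ be a $p$-modular system: $\mathcal{O}$ is a complete discrete valuation ring with field of fractions $K$ of characteristic $0$ and residue field $k=\mathcal{O}/J(\mathcal{O})$ of characteristic $p$. Assume that $k$ is perfect and that $\mathcal{O}$ is absolutely unramified, that is, $J(\mathcal{O})=p\mathcal{O}$. Let $\bar K$ be an algebraic closure of $K$. For $n\ge 1$ write $n_{p'}$ for the $p'$-part of $n$, $\mathbb{Q}_n\subseteq\bar K$ for the $n$-th cyclotomic field, and $k'$ for a splitting field of $x^{n_{p'}}-1$ over $k$. Let $\mathcal{H}_{n,k}$ be the group of those $\alpha\in\mathrm{Gal}(\mathbb{Q}_n/\mathbb{Q})$ for which there are an integer $u\ge 0$ and $\tau\in\mathrm{Gal}(k'/k)$ such that $\alpha(\delta)=\delta^{p^u}$ for all $n_{p'}$-th roots of unity $\delta\in\mathbb{Q}_n$ and $\tau(\eta)=\eta^{p^u}$ for all $n_{p'}$-th roots of unity $\eta\in k'$. For a finite group $G$ and a central idempotent $b$ of $\mathcal{O}G$, let $\mathrm{IBr}(G,b)$ be the set of Brauer characters of the simple $\bar kG$-modules on which the image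 of $b$ in $\bar kG$ acts as the identity, where $\bar k$ is an algebraic closure of $k$. They are regarded as functions from the set of $p$-regular elements of $G$ to $\bar K$, by lifting eigenvalues along an $\mathcal{O}$-algebra homomorphism to $\bar k$ from the integral closure of $\mathcal{O}$ in $\bar K$, which is fixed once for all groups. For $\mathcal{O}$-algebras $A$ and $B$, let $\mathcal{P}(A,B)$ be the Grothendieck group, with respect to direct sums, of the $(A,B)$-bimodules (with the same action of $\mathcal{O}$ on both sides) which are finitely generated projective both as left $A$-modules and as right $B$-modules; its elements are called virtual bimodules. Tensoring over $B$ induces a product $\mathcal{P}(A,B)\times\mathcal{P}(B,C)\to\mathcal{P}(A,C)$, written $X\cdot_B Y$. Elements $X\in\mathcal{P}(A,B)$ and $Y\in\mathcal{P}(B,A)$ induce a virtual Morita equivalence between $A$ and $B$ if $X\cdot_B Y=[A]$ in $\mathcal{P}(A,A)$ and $Y\cdot_A X=[B]$ in $\mathcal{P}(B,B)$. The dual $X^*$ of $X$ is obtained by applying $\mathrm{Hom}_{\mathcal{O}}(-,\mathcal{O})$. **Theorem.** Let $G$ and $H$ be finite groups, let $n$ be a positive integer which is a multiple of $|G|$ and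 of $|H|$, and let $b$ and $c$ be block idempotents (primitive idempotents of the center) of $\mathcal{O}G$ and $\mathcal{O}H$ respectively. Suppose that some $X\in\mathcal{P}(\mathcal{O}Gb,\mathcal{O}Hc)$ and its dual $X^*$ induce a virtual Morita equivalence between $\mathcal{O}Gb$ and $\mathcal{O}Hc$. Then $\mathcal{H}_{n,k}$ acts on $\mathrm{IBr}(G,b)$ and $\mathrm{IBr}(H,c)$ by ${}^\sigma\varphi(g)=\sigma(\varphi(g))$, and there is a bijection $I:\mathrm{IBr}(G,b)\to\mathrm{IBr}(H,c)$ such that ${}^\sigma I(\varphi)=I({}^\sigma\varphi)$ for all $\varphi\in\mathrm{IBr}(G,b)$ and all $\sigma\in\mathcal{H}_{n,k}$. -/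

import Mathlib

open scoped TensorProduct
open MulOpposite

universe w w' w'' u v v₁ v₂ v₃

noncomputable section

/-! ### Bimodules and virtual bimodules -/

/-- An `(A, B)`-bimodule over the commutative ring `O`: a left `A`-module and right `B`-module
whose two actions commute and restrict to the same action of `O`. -/
structure AlgBimod (O : Type u) (A : Type v₁) (B : Type v₂) [CommRing O] [Ring A] [Algebra O A]
    [Ring B] [Algebra O B] where
  /-- the underlying type -/
  carrier : Type w
  [addCommGroup : AddCommGroup carrier]
  [moduleBase : Module O carrier]
  [moduleLeft : Module A carrier]
  [moduleRight : Module Bᵐᵒᵖ carrier]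
  [towerLeft : IsScalarTower O A carrier]
  [towerRight : IsScalarTower O Bᵐᵒᵖ carrier]
  [comm : SMulCommClass A Bᵐᵒᵖ carrier]

namespace AlgBimod

attribute [instance] addCommGroup moduleBase moduleLeft moduleRight towerLeft towerRight comm

section
variable {O : Type u} {A : Type v₁} {B : Type v₂} {C : Type v₃} [CommRing O]
  [Ring A] [Algebra O A] [Ring B] [Algebra O B] [Ring C] [Algebra O C]

instance (M : AlgBimod.{w} O A B) : SMulCommClass A O M.carrier := IsScalarTower.to_smulCommClass'
instance (M : AlgBimod.{w} O A B) : SMulCommClass Bᵐᵒᵖ O M.carrier := IsScalarTower.to_smulCommClass'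

/-- The left action, as an algebra homomorphism. -/
def lact (M : AlgBimod.{w} O A B) : A →ₐ[O] Module.End O M.carrier := Algebra.lsmul O O M.carrier

/-- The right action, as an algebra homomorphism. -/
def ract (M : AlgBimod.{w} O A B) : Bᵐᵒᵖ →ₐ[O] Module.End O M.carrier := Algebra.lsmul O O M.carrier

theorem lact_apply (M : AlgBimod.{w} O A B) (a : A) (m : M.carrier) : M.lact a m = a • m := rfl

theorem ract_apply (M : AlgBimod.{w} O A B) (b : Bᵐᵒᵖ) (m : M.carrier) : M.ract b m = b • m := rfl

/-- Constructing a bimodule from its two actions. -/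
def ofHoms (M : Type w) [AddCommGroup M] [Module O M] (l : A →ₐ[O] Module.End O M)
    (r : Bᵐᵒᵖ →ₐ[O] Module.End O M) (h : ∀ a b m, l a (r b m) = r b (l a m)) :
    AlgBimod.{w} O A B :=
  letI : Module A M := Module.compHom M l.toRingHom
  letI : Module Bᵐᵒᵖ M := Module.compHom M r.toRingHom
  { carrier := M
    towerLeft := ⟨fun o a m => by
      change l (o • a) m = o • l a m
      rw [map_smul]; rfl⟩
    towerRight := ⟨fun o a m => by
      change r (o • a) m = o • r a m
      rw [map_smul]; rfl⟩
    comm := ⟨h⟩ }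

/-- `A` as an `(A, A)`-bimodule. -/
def regular (O : Type u) (A : Type v₁) [CommRing O] [Ring A] [Algebra O A] : AlgBimod.{v₁} O A A where
  carrier := A

/-- The zero bimodule. -/
def zero (O : Type u) (A : Type v₁) (B : Type v₂) [CommRing O] [Ring A] [Algebra O A]
    [Ring B] [Algebra O B] : AlgBimod.{w} O A B where
  carrier := PUnit

/-- The direct sum of two bimodules. -/
def sum (M : AlgBimod.{w} O A B) (N : AlgBimod.{w'} O A B) : AlgBimod.{max w w'} O A B where
  carrier := M.carrier × N.carrier

/-- Two bimodules are isomorphic. -/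
def Iso (M : AlgBimod.{w} O A B) (N : AlgBimod.{w'} O A B) : Prop :=
  ∃ e : M.carrier ≃ₗ[O] N.carrier,
    (∀ (a : A) (m : M.carrier), e (a • m) = a • e m) ∧
    ∀ (b : B) (m : M.carrier), e (op b • m) = op b • e m

/-- The bimodule is finitely generated projective both as a left and as a right module. -/
structure IsPerfect (M : AlgBimod.{w} O A B) : Prop where
  finite_left : Module.Finite A M.carrier
  projective_left : Module.Projective A M.carrier
  finite_right : Module.Finite Bᵐᵒᵖ M.carrier
  projective_right : Module.Projective Bᵐᵒᵖ M.carrier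

/-- The `O`-dual `Hom_O(M, O)` of an `(A, B)`-bimodule `M`, a `(B, A)`-bimodule through
`(b • f • a) m = f (a • m • b)`. -/
def dual (M : AlgBimod.{w} O A B) : AlgBimod.{max w u} O B A :=
  ofHoms (M.carrier →ₗ[O] O)
    (AlgHom.ofLinearMap
      { toFun := fun b => LinearMap.lcomp O O (M.ract (op b))
        map_add' := fun b c => by ext f m; simp
        map_smul' := fun o b => by ext f m; simp }
      (by ext f m; simp)
      (fun b c => by ext f m; simp))
    (AlgHom.ofLinearMap
      { toFun := fun a => LinearMap.lcomp O O (M.lact a.unop)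
        map_add' := fun b c => by ext f m; simp
        map_smul' := fun o b => by ext f m; simp }
      (by ext f m; simp)
      (fun b c => by ext f m; simp))
    (fun b a f => by
      ext m
      change f (a.unop • op b • m) = f (op b • a.unop • m)
      rw [smul_comm])

/-- The `O`-submodule of `M ⊗[O] N` whose quotient is `M ⊗_B N`. -/
def balanced (M : AlgBimod.{w} O A B) (N : AlgBimod.{w'} O B C) :
    Submodule O (M.carrier ⊗[O] N.carrier) :=
  Submodule.span O
    {x | ∃ (b : B) (m : M.carrier) (n : N.carrier), x = (op b • m) ⊗ₜ[O] n - m ⊗ₜ[O] (b • n)}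

theorem balanced_le_left (M : AlgBimod.{w} O A B) (N : AlgBimod.{w'} O B C) (a : A) :
    balanced M N ≤ (balanced M N).comap (LinearMap.rTensor N.carrier (M.lact a)) := by
  refine Submodule.span_le.2 ?_
  rintro _ ⟨b, m, n, rfl⟩
  refine Submodule.subset_span ⟨b, a • m, n, ?_⟩
  simp [lact_apply, smul_comm]

theorem balanced_le_right (M : AlgBimod.{w} O A B) (N : AlgBimod.{w'} O B C) (c : Cᵐᵒᵖ) :
    balanced M N ≤ (balanced M N).comap (LinearMap.lTensor M.carrier (N.ract c)) := by
  refine Submodule.span_le.2 ?_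
  rintro _ ⟨b, m, n, rfl⟩
  refine Submodule.subset_span ⟨b, m, c • n, ?_⟩
  simp [ract_apply, smul_comm]

/-- The left action on `M ⊗_B N`. -/
def tensorLeft (M : AlgBimod.{w} O A B) (N : AlgBimod.{w'} O B C) :
    A →ₐ[O] Module.End O ((M.carrier ⊗[O] N.carrier) ⧸ balanced M N) :=
  AlgHom.ofLinearMap
    { toFun := fun a => (balanced M N).mapQ (balanced M N)
        (LinearMap.rTensor N.carrier (M.lact a)) (balanced_le_left M N a)
      map_add' := fun a b => by ext m n; simp
      map_smul' := fun o a => by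
        ext m n; simp [← Submodule.Quotient.mk_smul] }
    (by ext m n; simp)
    (fun a b => by ext m n; simp)

/-- The right action on `M ⊗_B N`. -/
def tensorRight (M : AlgBimod.{w} O A B) (N : AlgBimod.{w'} O B C) :
    Cᵐᵒᵖ →ₐ[O] Module.End O ((M.carrier ⊗[O] N.carrier) ⧸ balanced M N) :=
  AlgHom.ofLinearMap
    { toFun := fun c => (balanced M N).mapQ (balanced M N)
        (LinearMap.lTensor M.carrier (N.ract c)) (balanced_le_right M N c)
      map_add' := fun a b => by ext m n; simp
      map_smul' := fun o a => by ext m n; simp }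
    (by ext m n; simp)
    (fun a b => by ext m n; simp)

theorem tensorLeft_mk_tmul (M : AlgBimod.{w} O A B) (N : AlgBimod.{w'} O B C) (a : A)
    (m : M.carrier) (n : N.carrier) :
    tensorLeft M N a (Submodule.Quotient.mk (m ⊗ₜ[O] n)) =
      Submodule.Quotient.mk ((a • m) ⊗ₜ[O] n) := rfl

theorem tensorRight_mk_tmul (M : AlgBimod.{w} O A B) (N : AlgBimod.{w'} O B C) (c : Cᵐᵒᵖ)
    (m : M.carrier) (n : N.carrier) :
    tensorRight M N c (Submodule.Quotient.mk (m ⊗ₜ[O] n)) =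
      Submodule.Quotient.mk (m ⊗ₜ[O] (c • n)) := rfl

theorem tensor_comm (M : AlgBimod.{w} O A B) (N : AlgBimod.{w'} O B C) (a : A) (c : Cᵐᵒᵖ)
    (x : (M.carrier ⊗[O] N.carrier) ⧸ balanced M N) :
    tensorLeft M N a (tensorRight M N c x) = tensorRight M N c (tensorLeft M N a x) := by
  have h : tensorLeft M N a ∘ₗ tensorRight M N c = tensorRight M N c ∘ₗ tensorLeft M N a := by
    apply Submodule.linearMap_qext
    apply TensorProduct.ext'
    intro m n
    rfl
  exact LinearMap.congr_fun h x

/-- The tensor product `M ⊗_B N` of an `(A, B)`- and a `(B, C)`-bimodule. -/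
def tensor (M : AlgBimod.{w} O A B) (N : AlgBimod.{w'} O B C) : AlgBimod.{max w w'} O A C :=
  ofHoms ((M.carrier ⊗[O] N.carrier) ⧸ balanced M N) (tensorLeft M N) (tensorRight M N)
    (tensor_comm M N)

end

end AlgBimod

/-- A virtual `(A, B)`-bimodule, given as a formal difference `pos - neg` of two bimodules. -/
structure VirtualBimod (O : Type u) (A : Type v₁) (B : Type v₂) [CommRing O] [Ring A]
    [Algebra O A] [Ring B] [Algebra O B] where
  /-- the positive part -/
  pos : AlgBimod.{w} O A B
  /-- the negative part -/
  neg : AlgBimod.{w} O A B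

namespace VirtualBimod

section
variable {O : Type u} {A : Type v₁} {B : Type v₂} {C : Type v₃} [CommRing O]
  [Ring A] [Algebra O A] [Ring B] [Algebra O B] [Ring C] [Algebra O C]

/-- The formal difference represents an element of the Grothendieck group `P(A, B)` (with respect
to split exact sequences, that is, to direct sums) of the category of bimodules which are finitely
generated projective on either side. -/
structure IsPerfect (X : VirtualBimod.{w} O A B) : Prop where
  pos : X.pos.IsPerfect
  neg : X.neg.IsPerfect

/-- The class `[M]` of a bimodule. -/
def of (M : AlgBimod.{w} O A B) : VirtualBimod.{w} O A B := ⟨M, AlgBimod.zero O A B⟩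

/-- Equality in the Grothendieck group `P(A, B)`: `X⁺ - X⁻ = Y⁺ - Y⁻` in the group completion of
the monoid of isomorphism classes. A finitely generated `W` has a copy in the universe of `A`. -/
def ClassEq (X : VirtualBimod.{w} O A B) (Y : VirtualBimod.{w'} O A B) : Prop :=
  ∃ W : AlgBimod.{v₁} O A B, W.IsPerfect ∧
    ((X.pos.sum Y.neg).sum W).Iso ((Y.pos.sum X.neg).sum W)

/-- The product `P(A, B) × P(B, C) → P(A, C)` induced by the tensor product over `B`. -/
def mul (X : VirtualBimod.{w} O A B) (Y : VirtualBimod.{w'} O B C) :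
    VirtualBimod.{max w w'} O A C where
  pos := (X.pos.tensor Y.pos).sum (X.neg.tensor Y.neg)
  neg := (X.pos.tensor Y.neg).sum (X.neg.tensor Y.pos)

/-- The `O`-dual of a virtual bimodule. -/
def dual (X : VirtualBimod.{w} O A B) : VirtualBimod.{max w u} O B A where
  pos := X.pos.dual
  neg := X.neg.dual

/-- `X ∈ P(A, B)` and `Y ∈ P(B, A)` induce a virtual Morita equivalence between `A` and `B`:
`X ·_B Y = [A]` in `P(A, A)` and `Y ·_A X = [B]` in `P(B, B)`. -/
structure InducesVirtualMorita (X : VirtualBimod.{w} O A B) (Y : VirtualBimod.{w'} O B A) :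
    Prop where
  perfect_left : X.IsPerfect
  perfect_right : Y.IsPerfect
  mul_left : (X.mul Y).ClassEq (of (AlgBimod.regular O A))
  mul_right : (Y.mul X).ClassEq (of (AlgBimod.regular O B))

end

end VirtualBimod

/-! ### Blocks -/

/-- `b` is a block idempotent of `A`: a primitive idempotent of the center of `A`. -/
structure IsBlockIdempotent {A : Type v} [Ring A] (b : A) : Prop where
  idem : IsIdempotentElem b
  central : b ∈ Subring.center A
  ne_zero : b ≠ 0
  primitive : ∀ e ∈ Subring.center A, IsIdempotentElem e → e * b = e → e = 0 ∨ e = b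

/-- The `O`-algebra structure of the ring `e A e` with identity `e`. -/
instance cornerAlgebra {O : Type u} {A : Type v} [CommRing O] [Ring A] [Algebra O A] {e : A}
    (he : IsIdempotentElem e) : Algebra O he.Corner :=
  letI : SMul O he.Corner := ⟨fun o x => ⟨o • x.1, by
    obtain ⟨y, hy⟩ := x.2
    exact ⟨o • y, by simp only [← hy, mul_smul_comm, smul_mul_assoc]⟩⟩⟩
  letI : Module O he.Corner :=
    { one_smul := fun x => Subtype.ext (one_smul O x.1)
      mul_smul := fun o o' x => Subtype.ext (mul_smul o o' x.1)
      smul_zero := fun o => Subtype.ext (smul_zero o)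
      smul_add := fun o x y => Subtype.ext (smul_add o x.1 y.1)
      add_smul := fun o o' x => Subtype.ext (add_smul o o' x.1)
      zero_smul := fun x => Subtype.ext (zero_smul O x.1) }
  Algebra.ofModule (fun o x y => Subtype.ext (smul_mul_assoc o x.1 y.1))
    (fun o x y => Subtype.ext (mul_smul_comm o x.1 y.1))

/-! ### Brauer characters -/

/-- The `p`-regular elements of `G`. -/
abbrev PRegular (p : ℕ) (G : Type v) [Group G] : Type v := {g : G // p.Coprime (orderOf g)}

section
variable {O : Type u} [CommRing O] {L : Type w} [Field L] [Algebra O L]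
  {F : Type w'} [Field F] [Algebra O F]

/-- `φ` is the Brauer character of the `F`-representation `ρ` of `G`, with respect to the
reduction homomorphism `π` from the ring of elements of `L` integral over `O` to `F`: for every
`p`-regular `g`, the value `φ g` is the sum, with multiplicities, of the lifts to roots of unity
in `L` (of order dividing the order of `g`) of the eigenvalues of `ρ g`. -/
def IsBrauerCharacterOf (p : ℕ) {G : Type v} [Group G] (π : integralClosure O L →ₐ[O] F) {d : ℕ}
    (ρ : Representation F G (Fin d → F)) (φ : PRegular p G → L) : Prop :=
  ∀ g : PRegular p G, ∃ s : Multiset (integralClosure O L),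
    (∀ z ∈ s, z ^ orderOf g.1 = 1) ∧ s.map π = (ρ g.1).charpoly.roots ∧
      φ g = (s.map fun z => (z : L)).sum

/-- `IBr(G, b)`: the Brauer characters of the simple `FG`-modules on which the image of `b` in
`FG` acts as the identity. -/
def IBr (p : ℕ) {G : Type v} [Group G] (π : integralClosure O L →ₐ[O] F)
    (b : MonoidAlgebra O G) : Set (PRegular p G → L) :=
  {φ | ∃ (d : ℕ) (ρ : Representation F G (Fin d → F)), ρ.IsIrreducible ∧
    ρ.asAlgebraHom (MonoidAlgebra.mapRingHom G (algebraMap O F) b) = 1 ∧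
    IsBrauerCharacterOf p π ρ φ}

end

/-! ### The Galois group -/

/-- The `n`-th cyclotomic subfield `ℚ_n` of `L`. -/
def cyclotomicSubfield (n : ℕ) (L : Type w) [Field L] [CharZero L] : IntermediateField ℚ L :=
  IntermediateField.adjoin ℚ {z : L | z ^ n = 1}

/-- The `p'`-part of `n`. -/
def pPrimePart (p n : ℕ) : ℕ := n / p ^ n.factorization p

/-- A splitting field of `x ^ m - 1` over `k`, where `m` is the `p'`-part of `n`. -/
abbrev rootsField (p n : ℕ) (k : Type v) [Field k] : Type v :=
  (Polynomial.X ^ pPrimePart p n - 1 : Polynomial k).SplittingField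

/-- If `α` raises the `m`-th roots of unity to the `q`-th power, where `q` is coprime to `m`, then
its inverse raises them to a power of `q`. -/
theorem pow_inverse {M : Type*} [Monoid M] (e : M ≃* M) {m q : ℕ} (hq : q.Coprime m) (u : ℕ)
    (h : ∀ z : M, z ^ m = 1 → e z = z ^ q ^ u) (z : M) (hz : z ^ m = 1) :
    e.symm z = z ^ q ^ (u * (m.totient - 1)) := by
  rcases Nat.eq_zero_or_pos m with rfl | hm
  · simp only [Nat.coprime_zero_right] at hq
    subst hq
    have := h z hz
    simp only [one_pow, pow_one] at this ⊢
    rw [MulEquiv.symm_apply_eq, this]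
  · rw [MulEquiv.symm_apply_eq, map_pow, h z hz, ← pow_mul, ← pow_add]
    have h1 : u + u * (m.totient - 1) = m.totient * u := by
      obtain ⟨t, ht⟩ := Nat.exists_eq_succ_of_ne_zero (Nat.totient_pos.2 hm).ne'
      rw [ht]; simp; ring
    rw [h1, pow_mul]
    have h2 : (q ^ m.totient) ^ u ≡ 1 [MOD m] := by
      simpa using (Nat.ModEq.pow_totient hq).pow u
    have h3 := pow_eq_pow_of_modEq h2 hz
    rw [h3, pow_one]

/-- The group `H_{n,k}` of those automorphisms `α` of `ℚ_n` for which there are `u ≥ 0` and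
`τ ∈ Gal(k'/k)` such that `α` raises the `m`-th roots of unity in `ℚ_n`, and `τ` those in `k'`, to
the power `p ^ u`; here `m` is the `p'`-part of `n` and `k'` a splitting field of `x ^ m - 1`
over `k`. -/
def galoisSubgroup (p n : ℕ) [hp : Fact p.Prime] [hn : NeZero n] (k : Type v) [Field k]
    (L : Type w) [Field L] [CharZero L] :
    Subgroup (cyclotomicSubfield n L ≃ₐ[ℚ] cyclotomicSubfield n L) where
  carrier := {α | ∃ (u : ℕ) (τ : rootsField p n k ≃ₐ[k] rootsField p n k),
    (∀ δ : cyclotomicSubfield n L, δ ^ pPrimePart p n = 1 → α δ = δ ^ p ^ u) ∧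
    ∀ η : rootsField p n k, η ^ pPrimePart p n = 1 → τ η = η ^ p ^ u}
  one_mem' := ⟨0, 1, by simp, by simp⟩
  mul_mem' := by
    rintro α β ⟨u, τ, h1, h2⟩ ⟨v, τ', h3, h4⟩
    refine ⟨u + v, τ * τ', fun δ hδ => ?_, fun η hη => ?_⟩
    · rw [AlgEquiv.mul_apply, h3 δ hδ, map_pow, h1 δ hδ, ← pow_mul, pow_add]
    · rw [AlgEquiv.mul_apply, h4 η hη, map_pow, h2 η hη, ← pow_mul, pow_add]
  inv_mem' := by
    rintro α ⟨u, τ, h1, h2⟩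
    have hc : p.Coprime (pPrimePart p n) := Nat.coprime_ordCompl hp.out hn.out
    exact ⟨u * ((pPrimePart p n).totient - 1), τ⁻¹,
      fun δ hδ => pow_inverse (α : cyclotomicSubfield n L ≃* cyclotomicSubfield n L) hc u h1 δ hδ,
      fun η hη => pow_inverse (τ : rootsField p n k ≃* rootsField p n k) hc u h2 η hη⟩

/-- `ψ` is the Galois conjugate `σ φ`, that is, `φ` takes its values in `ℚ_n` and
`ψ g = σ (φ g)` for all `g`. -/
def IsGaloisConj {n : ℕ} {L : Type w} [Field L] [CharZero L] {S : Type v}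
    (σ : cyclotomicSubfield n L ≃ₐ[ℚ] cyclotomicSubfield n L) (φ ψ : S → L) : Prop :=
  ∀ g : S, ∃ x : cyclotomicSubfield n L, (x : L) = φ g ∧ (σ x : L) = ψ g

end

noncomputable section

/-! ### Trace functionals and `p`-th powers -/

/-! Write F for the algebraic closure of k. The invariant carried across the equivalence is the
group `frobeniusTraces` of O-linear functionals t from an algebra to F with t(xy) = t(yx) and t(x^p)
= t(x)^p.

For a block A = OGb this group is the F_p-span of the characters of the simple FG-modules in the
block, and these characters are linearly independent (`SemisimpleQuotient.exists_coeff`,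
`IBr.combination_injective`, `IBr.combination_surjective`). Indeed t extends to FG and kills
nilpotent elements, so it lives on a product of matrix algebras. There it is a combination of matrix
traces, and each coefficient is its value c at an idempotent, so c^p = c. Hence the group is the
permutation module F_p^IBr(G,b), on which automorphisms of F over O act by permuting the simple
modules.

An (A,B)-bimodule that is finitely generated projective on the right pulls functionals on B back to
A by the Hattori–Stallings trace. The p-th power condition survives because in characteristic p a
trace functional does not see the mixed terms of (x + y)^p. The pullback is additive on direct sums,
turns tensor products into composites, is the identity for the regular bimodule and commutes with
automorphisms of F. Mutually inverse virtual bimodules therefore give an equivariant bijection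
F_p^IBr(G,b) ≃ F_p^IBr(H,c).

For a cyclic group, the permutation module over a finite field determines the permutation up to
relabelling: counting invariant functions counts the cycles of every power, and these numbers
determine the cycle type (`exists_equiv_of_permutationModule`). Finally, all of the Galois group
H_{n,k} acts on Brauer characters through powers of one automorphism of F
(`exists_actsAsPow_generator`), because p'-roots of unity lift uniquely along the reduction map. One
bijection commuting with that automorphism thus serves every σ. -/

theorem sum_pow_eq_sum_prod_ofFn {R ι : Type*} [Ring R] [Fintype ι] (x : ι → R) (n : ℕ) :
    (∑ i, x i) ^ n = ∑ f : Fin n → ι, (List.ofFn fun j => x (f j)).prod := by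
  induction n with
  | zero => simp
  | succ n ih =>
    rw [pow_succ', ih, Finset.sum_mul_sum, ← (Fin.consEquiv fun _ => ι).sum_comp,
      Fintype.sum_prod_type]
    simp [Fin.consEquiv]

/-- On each level set of `w` the permutation `r` has orbits of length 1 or p. Those of length p
contribute a multiple of p, which is zero in `F`. -/
theorem sum_eq_sum_fixedPoints {α F : Type*} [Fintype α] [DecidableEq α] [Ring F] (p : ℕ)
    [hp : Fact p.Prime] [CharP F p] (r : Equiv.Perm α) (hr : r ^ p = 1) (w : α → F)
    (hw : ∀ a, w (r a) = w a) :
    ∑ a, w a = ∑ a with r a = a, w a := by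
  classical
  rw [← Finset.sum_fiberwise_of_maps_to (t := Finset.univ.image w) (g := w) (by simp),
    ← Finset.sum_fiberwise_of_maps_to (s := Finset.univ.filter fun a => r a = a)
      (t := Finset.univ.image w) (g := w) (by simp)]
  refine Finset.sum_congr rfl fun v _ => ?_
  have h0 : ∀ s : Finset α, ∑ a ∈ s with w a = v, w a = ((s.filter fun a => w a = v).card : F) * v := by
    intro s
    rw [Finset.sum_congr rfl fun a ha => (Finset.mem_filter.1 ha).2, Finset.sum_const,
      nsmul_eq_mul]
  rw [h0, h0]
  congr 1
  rw [CharP.natCast_eq_natCast F p]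
  let r' : Equiv.Perm {a // w a = v} := r.subtypePerm fun a => by rw [hw]
  have hr' : r' ^ p ^ 1 = 1 := by
    rw [pow_one, Equiv.Perm.subtypePerm_pow]
    ext a
    simp [hr]
  have h := (Equiv.Perm.card_compl_support_modEq hr').symm
  rw [Fintype.card_subtype] at h
  refine h.trans ?_
  have : (r'.supportᶜ).map (Function.Embedding.subtype _) =
      (Finset.univ.filter fun a => r a = a).filter fun a => w a = v := by
    ext a
    simp [r', Subtype.ext_iff, and_comm]
  rw [← this, Finset.card_map]

/-- Rotation of functions on `Fin (k + 1)`. -/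
def rotatePerm (k : ℕ) (ι : Type*) : Equiv.Perm (Fin (k + 1) → ι) :=
  (Equiv.addRight (1 : Fin (k + 1))).arrowCongr (Equiv.refl ι) |>.symm

theorem rotatePerm_apply {k : ℕ} {ι : Type*} (f : Fin (k + 1) → ι) (i : Fin (k + 1)) :
    rotatePerm k ι f i = f (i + 1) := rfl

open Fin.NatCast in
theorem rotatePerm_pow_apply {k : ℕ} {ι : Type*} (m : ℕ) (f : Fin (k + 1) → ι)
    (i : Fin (k + 1)) : (rotatePerm k ι ^ m) f i = f (i + (m : Fin (k + 1))) := by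
  induction m generalizing f with
  | zero => simp
  | succ m ih =>
    rw [pow_succ, Equiv.Perm.mul_apply, ih, rotatePerm_apply, Nat.cast_succ, add_assoc]

open Fin.NatCast in
theorem rotatePerm_pow_card (k : ℕ) (ι : Type*) : rotatePerm k ι ^ (k + 1) = 1 := by
  ext f i
  rw [rotatePerm_pow_apply]
  simp

open Fin.NatCast in
theorem eq_const_of_rotatePerm_eq {k : ℕ} {ι : Type*} {f : Fin (k + 1) → ι}
    (h : rotatePerm k ι f = f) : f = fun _ => f 0 := by
  have key : ∀ m : ℕ, f (m : Fin (k + 1)) = f 0 := by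
    intro m
    induction m with
    | zero => simp
    | succ m ih => rw [← ih, Nat.cast_succ]; exact congrFun h (m : Fin (k + 1))
  funext i
  simpa using key i

/-- Rotating a word moves one end letter to the other end, which is exactly t(xy) = t(yx). -/
theorem map_prod_ofFn_rotatePerm {R F ι : Type*} [Ring R] (t : R → F)
    (ht : ∀ x y, t (x * y) = t (y * x)) {k : ℕ} (x : ι → R) (f : Fin (k + 1) → ι) :
    t (List.ofFn fun j => x (rotatePerm k ι f j)).prod = t (List.ofFn fun j => x (f j)).prod := by
  rw [List.ofFn_succ', List.ofFn_succ, List.concat_eq_append, List.prod_append, List.prod_cons,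
    List.prod_cons, List.prod_nil, mul_one, ht]
  simp [rotatePerm_apply]

/-- In characteristic `p`, a trace functional does not see the mixed terms of a `p`-th power. -/
theorem map_sum_pow_char {R F ι : Type*} [Ring R] [Ring F] (p : ℕ) [hp : Fact p.Prime] [CharP F p]
    (t : R →+ F) (ht : ∀ x y, t (x * y) = t (y * x)) (s : Finset ι) (x : ι → R) :
    t ((∑ i ∈ s, x i) ^ p) = ∑ i ∈ s, t (x i ^ p) := by
  classical
  obtain ⟨k, rfl⟩ : ∃ k, p = k + 1 := ⟨p - 1, (Nat.sub_add_cancel hp.out.pos).symm⟩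
  -- The power expands into noncommutative words of length p. Rotation acts on the words with order
  -- dividing p and preserves their traces, so only rotation-invariant words survive, and these are
  -- the constant ones.
  rw [← Finset.sum_coe_sort s x, sum_pow_eq_sum_prod_ofFn, map_sum,
    sum_eq_sum_fixedPoints (k + 1) (rotatePerm k s) (rotatePerm_pow_card k s)
      (fun f => t (List.ofFn fun j => x (f j)).prod)
      (fun f => map_prod_ofFn_rotatePerm t ht (fun i : s => x i) f),
    ← Finset.sum_coe_sort s fun i => t (x i ^ (k + 1))]
  refine Finset.sum_nbij' (fun f => f 0) (fun i _ => i) ?_ ?_ ?_ ?_ ?_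
  · simp
  · intro i _
    simp only [Finset.mem_filter, Finset.mem_univ, true_and]
    rfl
  · intro f hf
    exact (eq_const_of_rotatePerm_eq (Finset.mem_filter.1 hf).2).symm
  · simp
  · intro f hf
    rw [eq_const_of_rotatePerm_eq (Finset.mem_filter.1 hf).2]
    simp only [List.ofFn_const, List.prod_replicate]

/-- The trace functionals on the ring `A` with values in the ring `F` which commute with `p`-th
powers. -/
structure IsFrobeniusTrace {A F : Type*} [Ring A] [Ring F] (p : ℕ) (t : A →+ F) : Prop where
  map_mul_comm : ∀ x y, t (x * y) = t (y * x)
  map_pow : ∀ x, t (x ^ p) = t x ^ p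

theorem IsFrobeniusTrace.map_pow_pow {A F : Type*} [Ring A] [Ring F] {p : ℕ} {t : A →+ F}
    (ht : IsFrobeniusTrace p t) (x : A) (k : ℕ) : t (x ^ p ^ k) = t x ^ p ^ k := by
  induction k with
  | zero => simp
  | succ k ih => rw [pow_succ, pow_mul, ht.map_pow, ih, ← pow_mul]

/-- If x^k = 0 then x^(p^k) = 0 since k < p^k, so t(x)^(p^k) = t(0) = 0 in a field. -/
theorem IsFrobeniusTrace.map_eq_zero_of_isNilpotent {A F : Type*} [Ring A] [Field F] {p : ℕ}
    [hp : Fact p.Prime] {t : A →+ F} (ht : IsFrobeniusTrace p t) {x : A} (hx : IsNilpotent x) :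
    t x = 0 := by
  obtain ⟨k, hk⟩ := hx
  have h := ht.map_pow_pow x k
  rw [pow_eq_zero_of_le (Nat.lt_pow_self hp.out.one_lt).le hk, map_zero] at h
  exact pow_eq_zero_iff (pow_ne_zero k hp.out.ne_zero) |>.1 h.symm

/-- A Frobenius trace on `B` composed with the trace of matrices over `B`. -/
theorem IsFrobeniusTrace.matrix {B F ι : Type*} [Ring B] [Field F] [Fintype ι] [DecidableEq ι]
    {p : ℕ} [hp : Fact p.Prime] [CharP F p] {t : B →+ F} (ht : IsFrobeniusTrace p t) :
    IsFrobeniusTrace p (t.comp (Matrix.traceAddMonoidHom ι B)) := by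
  have hcomm : ∀ x y : Matrix ι ι B, t (x * y).trace = t (y * x).trace := by
    intro x y
    simp only [Matrix.trace, Matrix.diag_apply, Matrix.mul_apply, map_sum]
    rw [Finset.sum_comm]
    exact Finset.sum_congr rfl fun i _ => Finset.sum_congr rfl fun j _ => ht.map_mul_comm _ _
  refine ⟨hcomm, fun M => ?_⟩
  have hM : M = ∑ q : ι × ι, Matrix.single q.1 q.2 (M q.1 q.2) := by
    rw [Fintype.sum_prod_type]; exact Matrix.matrix_eq_sum_single M
  have h1 : ∀ (i j : ι) (a : B), i ≠ j → Matrix.single i j a ^ p = 0 := by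
    intro i j a hij
    refine pow_eq_zero_of_le hp.out.two_le ?_
    rw [pow_two, Matrix.single_mul_single_of_ne _ _ _ _ hij.symm]
  have h2 : ∀ (i : ι) (a : B) (k : ℕ), Matrix.single i i a ^ (k + 1) = Matrix.single i i (a ^ (k + 1)) := by
    intro i a k
    induction k with
    | zero => simp
    | succ k ih => rw [pow_succ, ih, Matrix.single_mul_single_same, ← pow_succ]
  conv_lhs => rw [hM]
  -- Apply the p-th power formula to the expansion of `M` into single-entry matrices: off-diagonal
  -- ones square to zero, diagonal ones contribute t((M i i)^p) = t(M i i)^p.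
  rw [map_sum_pow_char p _ hcomm, Fintype.sum_prod_type]
  have h3 : ∀ i j, t (Matrix.single i j (M i j) ^ p).trace = if i = j then t (M i i) ^ p else 0 := by
    intro i j
    split_ifs with h
    · subst h
      rw [← ht.map_pow]
      obtain ⟨k, hk⟩ : ∃ k, p = k + 1 := ⟨p - 1, (Nat.sub_add_cancel hp.out.pos).symm⟩
      rw [hk, h2, Matrix.trace_single_eq_same]
    · rw [h1 i j _ h]; simp
  simp only [AddMonoidHom.comp_apply, Matrix.traceAddMonoidHom_apply, h3]
  simp [Matrix.trace, sum_pow_char p]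

/-- The map `f` need not be unital: it will be the action of an algebra in terms of a dual basis, or
the inclusion of a corner ring. Only positive powers are therefore compared, whence `p ≠ 0`. -/
theorem IsFrobeniusTrace.comp {A B F : Type*} [Ring A] [Ring B] [Ring F] {p : ℕ}
    {t : B →+ F} (ht : IsFrobeniusTrace p t) (f : A →+ B) (hf : ∀ x y, f (x * y) = f x * f y)
    (hp : p ≠ 0) :
    IsFrobeniusTrace p (t.comp f) := by
  refine ⟨fun x y => by simp [hf, ht.map_mul_comm (f x)], fun x => ?_⟩
  have : ∀ k : ℕ, f (x ^ (k + 1)) = f x ^ (k + 1) := by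
    intro k
    induction k with
    | zero => simp
    | succ k ih => rw [pow_succ, hf, ih, ← pow_succ]
  obtain ⟨k, rfl⟩ := Nat.exists_eq_succ_of_ne_zero hp
  simp [this, ht.map_pow]

theorem isFrobeniusTrace_of_matrix {F ι : Type*} [Field F] [Fintype ι] [DecidableEq ι]
    (p : ℕ) [hp : Fact p.Prime] [CharP F p] :
    IsFrobeniusTrace p (Matrix.traceAddMonoidHom ι F) :=
  IsFrobeniusTrace.matrix (t := AddMonoidHom.id F) ⟨fun x y => mul_comm x y, fun _ => rfl⟩

/-! ### Permutations with isomorphic permutation modules -/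

/-- A class with c elements contributes c times 1/c. -/
theorem card_quotient_eq_sum_inv {X : Type*} [Fintype X] (s : Setoid X) :
    (Nat.card (Quotient s) : ℚ) = ∑ x, (Nat.card {y // s x y} : ℚ)⁻¹ := by
  classical
  rw [← Finset.sum_fiberwise Finset.univ (fun x => (Quotient.mk s x)), Nat.card_eq_fintype_card,
    ← Finset.card_univ, Finset.card_eq_sum_ones, Nat.cast_sum]
  refine Finset.sum_congr rfl fun q _ => ?_
  induction q using Quotient.inductionOn with
  | h z =>
  have h : ∀ x ∈ Finset.univ.filter fun x => Quotient.mk s x = Quotient.mk s z,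
      (Nat.card {y // s x y} : ℚ)⁻¹ =
        ((Finset.univ.filter fun x => Quotient.mk s x = Quotient.mk s z).card : ℚ)⁻¹ := by
    intro x hx
    rw [← Fintype.card_subtype, Nat.card_eq_fintype_card]
    congr 2
    refine Fintype.card_congr (Equiv.subtypeEquivRight fun y => ?_)
    rw [← (Finset.mem_filter.1 hx).2, Quotient.eq]
    exact ⟨s.symm', s.symm'⟩
  rw [Finset.sum_congr rfl h, Finset.sum_const, nsmul_eq_mul, mul_inv_cancel₀]
  · simp
  · rw [Nat.cast_ne_zero]
    exact Finset.card_ne_zero_of_mem (a := z) (by simp)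

theorem card_sameCycle_eq_minimalPeriod {X : Type*} (γ : Equiv.Perm X) (x : X) :
    Nat.card {y // γ.SameCycle x y} = Function.minimalPeriod γ x := by
  have h := Nat.card_congr (MulAction.orbitZPowersEquiv γ x)
  rw [Nat.card_zmod] at h
  rw [show Function.minimalPeriod γ x = Function.minimalPeriod (γ • ·) x from rfl, ← h]
  refine Nat.card_congr (Equiv.subtypeEquivRight fun y => ?_)
  rw [MulAction.mem_orbit_iff]
  constructor
  · rintro ⟨i, hi⟩
    exact ⟨⟨γ ^ i, i, rfl⟩, hi⟩
  · rintro ⟨⟨_, i, rfl⟩, hi⟩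
    exact ⟨i, hi⟩

theorem minimalPeriod_perm_pos {X : Type*} [Finite X] (γ : Equiv.Perm X) (x : X) :
    0 < Function.minimalPeriod γ x := by
  rw [← card_sameCycle_eq_minimalPeriod]
  have : Nonempty {y // γ.SameCycle x y} := ⟨⟨x, .refl _ _⟩⟩
  exact Nat.card_pos

theorem minimalPeriod_perm_le {X : Type*} [Finite X] (γ : Equiv.Perm X) (x : X) :
    Function.minimalPeriod γ x ≤ Nat.card X := by
  rw [← card_sameCycle_eq_minimalPeriod]
  exact Nat.card_le_card_of_injective _ Subtype.val_injective

/-- The number of cycles of `γ` of length divisible by `d`. -/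
def numCyclesDvd {X : Type*} [Fintype X] (γ : Equiv.Perm X) (d : ℕ) : ℚ :=
  ∑ x, if d ∣ Function.minimalPeriod γ x then (Function.minimalPeriod γ x : ℚ)⁻¹ else 0

/-- A point of period m under `γ` has period m / gcd(m,i) under `γ ^ i`, so it contributes
gcd(m,i)/m to the number of cycles. Expanding gcd(m,i) as the sum of φ(d) over its divisors d
separates the dependence on i from that on m. -/
theorem card_quotient_sameCycle_pow {X : Type*} [Fintype X] (γ : Equiv.Perm X) {i : ℕ}
    (hi : i ≠ 0) :
    (Nat.card (Quotient (Equiv.Perm.SameCycle.setoid (γ ^ i))) : ℚ) =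
      ∑ d ∈ i.divisors, (d.totient : ℚ) * numCyclesDvd γ d := by
  rw [card_quotient_eq_sum_inv]
  simp only [numCyclesDvd, Finset.mul_sum]
  rw [Finset.sum_comm]
  refine Finset.sum_congr rfl fun x _ => ?_
  have hpos := minimalPeriod_perm_pos γ x
  have h1 : Nat.card {y // (Equiv.Perm.SameCycle.setoid (γ ^ i)) x y} =
      Function.minimalPeriod γ x / Nat.gcd (Function.minimalPeriod γ x) i := by
    rw [← Function.minimalPeriod_iterate_eq_div_gcd hi, ← Equiv.Perm.coe_pow,
      ← card_sameCycle_eq_minimalPeriod]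
    rfl
  rw [h1]
  generalize Function.minimalPeriod γ x = m at *
  rw [Nat.cast_div (Nat.gcd_dvd_left _ _) (Nat.cast_ne_zero.2 (Nat.gcd_pos_of_pos_left _ hpos).ne'),
    inv_div, div_eq_mul_inv]
  conv_lhs => rw [← Nat.sum_totient (m.gcd i)]
  rw [Nat.cast_sum, Finset.sum_mul]
  simp only [mul_ite, mul_zero]
  rw [← Finset.sum_filter]
  refine Finset.sum_congr ?_ fun _ _ => rfl
  ext d
  simp only [Nat.mem_divisors, Finset.mem_filter, Nat.dvd_gcd_iff]
  have := (Nat.gcd_pos_of_pos_left i hpos).ne'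
  tauto

/-- The formula for the number of cycles of the powers is a triangular system for divisibility, with
nonzero diagonal entries φ(d), so it can be solved by strong induction on d. -/
theorem numCyclesDvd_eq_of_card_quotient_eq {X Y : Type*} [Fintype X] [Fintype Y]
    (α : Equiv.Perm X) (β : Equiv.Perm Y)
    (h : ∀ i : ℕ, Nat.card (Quotient (Equiv.Perm.SameCycle.setoid (α ^ i))) =
      Nat.card (Quotient (Equiv.Perm.SameCycle.setoid (β ^ i)))) (d : ℕ) (hd : d ≠ 0) :
    numCyclesDvd α d = numCyclesDvd β d := by
  induction d using Nat.strong_induction_on with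
  | _ d ih =>
  have h1 := card_quotient_sameCycle_pow α hd
  rw [h d, card_quotient_sameCycle_pow β hd, ← Nat.insert_self_properDivisors hd,
    Finset.sum_insert (by simp), Finset.sum_insert (by simp)] at h1
  have h2 : ∑ e ∈ d.properDivisors, (e.totient : ℚ) * numCyclesDvd α e =
      ∑ e ∈ d.properDivisors, (e.totient : ℚ) * numCyclesDvd β e := by
    refine Finset.sum_congr rfl fun e he => ?_
    rw [ih e (Nat.mem_properDivisors.1 he).2 (Nat.pos_of_mem_properDivisors he).ne']
  rw [h2] at h1
  have h3 : (d.totient : ℚ) ≠ 0 := by simpa using hd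
  exact (mul_left_cancel₀ h3 (add_right_cancel h1)).symm

/-- The number of points of period `j` of a permutation. -/
def numPeriod {X : Type*} [Fintype X] (γ : Equiv.Perm X) (j : ℕ) : ℕ :=
  Nat.card {x // Function.minimalPeriod γ x = j}

theorem numPeriod_eq_zero {X : Type*} [Fintype X] (γ : Equiv.Perm X) {j : ℕ}
    (hj : Nat.card X < j) : numPeriod γ j = 0 := by
  have : IsEmpty {x // Function.minimalPeriod γ x = j} :=
    ⟨fun x => (minimalPeriod_perm_le γ x.1).not_gt (by rw [x.2]; exact hj)⟩
  exact Nat.card_of_isEmpty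

theorem numPeriod_zero {X : Type*} [Fintype X] (γ : Equiv.Perm X) : numPeriod γ 0 = 0 := by
  have : IsEmpty {x // Function.minimalPeriod γ x = 0} :=
    ⟨fun x => (minimalPeriod_perm_pos γ x.1).ne' x.2⟩
  exact Nat.card_of_isEmpty

theorem numCyclesDvd_eq_sum {X : Type*} [Fintype X] (γ : Equiv.Perm X) (d : ℕ) {N : ℕ}
    (hN : Nat.card X ≤ N) :
    numCyclesDvd γ d = ∑ j ∈ Finset.range (N + 1) with d ∣ j, (numPeriod γ j : ℚ) * (j : ℚ)⁻¹ := by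
  classical
  rw [numCyclesDvd, ← Finset.sum_filter,
    ← Finset.sum_fiberwise_of_maps_to (t := Finset.range (N + 1) |>.filter (d ∣ ·))
      (g := fun x => Function.minimalPeriod γ x)]
  · refine Finset.sum_congr rfl fun j hj => ?_
    rw [Finset.sum_congr rfl (g := fun _ => (j : ℚ)⁻¹) fun x hx => by
      rw [(Finset.mem_filter.1 hx).2], Finset.sum_const, nsmul_eq_mul, numPeriod,
      Nat.card_eq_fintype_card, Fintype.card_subtype, Finset.filter_filter]
    congr 3
    ext x
    simp only [Finset.mem_filter, Finset.mem_univ, true_and]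
    exact ⟨fun h => h.2, fun h => ⟨h ▸ (Finset.mem_filter.1 hj).2, h⟩⟩
  · intro x hx
    simp only [Finset.mem_filter, Finset.mem_univ, true_and, Finset.mem_range] at hx ⊢
    exact ⟨Nat.lt_succ_of_le ((minimalPeriod_perm_le γ x).trans hN), hx⟩

/-- Among the positive multiples of j, j is the smallest. As no period exceeds the number of points,
descending induction on j isolates the term at j. -/
theorem numPeriod_eq_of_numCyclesDvd_eq {X Y : Type*} [Fintype X] [Fintype Y]
    (α : Equiv.Perm X) (β : Equiv.Perm Y)
    (h : ∀ d ≠ 0, numCyclesDvd α d = numCyclesDvd β d) (j : ℕ) :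
    numPeriod α j = numPeriod β j := by
  obtain rfl | hj := eq_or_ne j 0
  · rw [numPeriod_zero, numPeriod_zero]
  set N := max (Nat.card X) (Nat.card Y) with hN
  have key : ∀ k j : ℕ, j ≠ 0 → N + 1 - j ≤ k → numPeriod α j = numPeriod β j := by
    intro k
    induction k with
    | zero =>
      intro j _ hk
      rw [numPeriod_eq_zero α (by omega), numPeriod_eq_zero β (by omega)]
    | succ k ih =>
      intro j hj hk
      by_cases hjN : N < j
      · rw [numPeriod_eq_zero α (by omega), numPeriod_eq_zero β (by omega)]
      have h1 := h j hj
      have hmem : j ∈ (Finset.range (N + 1)).filter (j ∣ ·) := by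
        simp; omega
      rw [numCyclesDvd_eq_sum α j (le_max_left _ _ : _ ≤ N),
        numCyclesDvd_eq_sum β j (le_max_right _ _ : _ ≤ N),
        ← Finset.add_sum_erase _ _ hmem, ← Finset.add_sum_erase _ _ hmem] at h1
      have h2 : ∀ i ∈ ((Finset.range (N + 1)).filter (j ∣ ·)).erase j,
          (numPeriod α i : ℚ) * (i : ℚ)⁻¹ = (numPeriod β i : ℚ) * (i : ℚ)⁻¹ := by
        intro i hi
        -- The index 0 is a multiple of every j, but its term vanishes because the inverse of 0 is
        -- 0.
        by_cases hi0 : i = 0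
        · simp [hi0]
        simp only [Finset.mem_erase, Finset.mem_filter, Finset.mem_range] at hi
        have := Nat.le_of_dvd (Nat.pos_of_ne_zero hi0) hi.2.2
        rw [ih i hi0 (by omega)]
      rw [Finset.sum_congr rfl h2] at h1
      have h3 := mul_right_cancel₀ (inv_ne_zero (Nat.cast_ne_zero.2 hj)) (add_right_cancel h1)
      exact_mod_cast h3
  exact key _ j hj le_rfl

/-- Each cycle of length j carries exactly j points of period j. The bound 2 ≤ j is needed because
`cycleType` omits fixed points. -/
theorem count_cycleType_mul {X : Type*} [Fintype X] [DecidableEq X] (γ : Equiv.Perm X) {j : ℕ}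
    (hj : 2 ≤ j) : γ.cycleType.count j * j = numPeriod γ j := by
  have hper : ∀ x ∈ γ.support, (γ.cycleOf x).support.card = Function.minimalPeriod γ x := by
    intro x hx
    rw [← card_sameCycle_eq_minimalPeriod, Nat.card_eq_fintype_card, Fintype.card_subtype]
    congr 1
    ext y
    rw [Equiv.Perm.mem_support_cycleOf_iff, and_iff_left hx]
    simp
  have hsupp : ∀ x, Function.minimalPeriod γ x = j → x ∈ γ.support := by
    intro x hx
    rw [Equiv.Perm.mem_support]
    intro h
    have : Function.minimalPeriod γ x = 1 := Function.minimalPeriod_eq_one_iff_isFixedPt.2 h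
    omega
  have h1 : numPeriod γ j = (γ.support.filter fun x => (γ.cycleOf x).support.card = j).card := by
    rw [numPeriod, Nat.card_eq_fintype_card, Fintype.card_subtype]
    congr 1
    ext x
    simp only [Finset.mem_filter, Finset.mem_univ, true_and]
    exact ⟨fun h => ⟨hsupp x h, (hper x (hsupp x h)).trans h⟩, fun h => (hper x h.1).symm.trans h.2⟩
  rw [h1, Finset.card_eq_sum_card_fiberwise (f := fun x => γ.cycleOf x)
    (t := γ.cycleFactorsFinset.filter fun c => c.support.card = j)]
  · rw [Finset.sum_congr rfl (g := fun _ => j), Finset.sum_const, smul_eq_mul,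
      Equiv.Perm.cycleType_def, Multiset.count_map]
    · congr 1
      rw [Finset.card_def, Finset.filter_val]
      congr 1
      refine Multiset.filter_congr fun c _ => ?_
      exact eq_comm
    · intro c hc
      obtain ⟨hc1, hc2⟩ := Finset.mem_filter.1 hc
      rw [← hc2]
      congr 1
      ext x
      simp only [Finset.mem_filter]
      constructor
      · rintro ⟨⟨hx, -⟩, rfl⟩
        rwa [Equiv.Perm.mem_support_cycleOf_iff, and_iff_right (.refl _ _)]
      · intro hx
        have hx' := Equiv.Perm.cycle_is_cycleOf hx hc1
        refine ⟨⟨Equiv.Perm.mem_cycleFactorsFinset_support_le hc1 hx, ?_⟩, hx'.symm⟩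
        rw [← hx', hc2]
  · intro x hx
    simp only [Finset.coe_filter, Set.mem_ofPred_eq] at hx ⊢
    exact ⟨Equiv.Perm.cycleOf_mem_cycleFactorsFinset_iff.2 hx.1, hx.2⟩

theorem isConj_of_numPeriod_eq {X : Type*} [Fintype X] (α β : Equiv.Perm X)
    (h : ∀ j, numPeriod α j = numPeriod β j) : IsConj α β := by
  classical
  rw [Equiv.Perm.isConj_iff_cycleType_eq]
  ext j
  by_cases hj : 2 ≤ j
  · have := (count_cycleType_mul α hj).trans ((h j).trans (count_cycleType_mul β hj).symm)
    exact Nat.eq_of_mul_eq_mul_right (by omega) this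
  · rw [Multiset.count_eq_zero_of_notMem, Multiset.count_eq_zero_of_notMem]
    · exact fun h => hj (Equiv.Perm.two_le_of_mem_cycleType h)
    · exact fun h => hj (Equiv.Perm.two_le_of_mem_cycleType h)

/-- The functions invariant under `γ` are the functions on its set of cycles. -/
def invariantFunctionsEquiv {X F : Type*} (γ : Equiv.Perm X) :
    {f : X → F // f ∘ γ = f} ≃ (Quotient (Equiv.Perm.SameCycle.setoid γ) → F) where
  toFun f := Quotient.lift f.1 (by
    rintro x _ ⟨i, rfl⟩
    have h1 : ∀ x, f.1 (γ x) = f.1 x := congrFun f.2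
    have h2 : ∀ x, f.1 (γ⁻¹ x) = f.1 x := fun x => by
      rw [← h1]; exact congrArg f.1 (γ.apply_symm_apply x)
    induction i generalizing x with
    | zero => simp
    | succ i ih => rw [zpow_add_one, Equiv.Perm.mul_apply, ← ih, h1]
    | pred i ih => rw [zpow_sub_one, Equiv.Perm.mul_apply, ← ih, h2])
  invFun g := ⟨fun x => g ⟦x⟧, by
    funext x
    exact congrArg g (Quotient.sound (s := Equiv.Perm.SameCycle.setoid γ) ⟨-1, by simp⟩)⟩
  left_inv f := rfl
  right_inv g := by
    funext q
    induction q using Quotient.inductionOn with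
    | h x => rfl

/-- Linearity of `e` plays no role. It matches the functions invariant under `α ^ i` with those
invariant under `β ^ i`; their numbers are |F| to the number of cycles, so all powers have equally
many cycles and the cycle types agree. -/
theorem exists_equiv_of_permutationModule {X Y F : Type*} [Finite X] [Finite Y] [Finite F]
    [Nontrivial F] (α : Equiv.Perm X) (β : Equiv.Perm Y) (e : (X → F) ≃ (Y → F))
    (he : ∀ f, e (f ∘ α) = e f ∘ β) : ∃ I : X ≃ Y, ∀ x, I (α x) = β (I x) := by
  classical
  have := Fintype.ofFinite X
  have := Fintype.ofFinite Y
  have hF : 1 < Nat.card F := Finite.one_lt_card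
  have hcard : Nat.card X = Nat.card Y := by
    have h := Nat.card_congr e
    rw [Nat.card_fun, Nat.card_fun] at h
    exact Nat.pow_right_injective hF h
  obtain ⟨I₀⟩ := Finite.card_eq.1 hcard
  have hpow : ∀ (i : ℕ) f, e (f ∘ (α ^ i : Equiv.Perm X)) = e f ∘ (β ^ i : Equiv.Perm Y) := by
    intro i
    induction i with
    | zero => intro f; rfl
    | succ i ih =>
      intro f
      rw [pow_succ, pow_succ, Equiv.Perm.coe_mul, Equiv.Perm.coe_mul, ← Function.comp_assoc, he, ih,
        Function.comp_assoc]
  have hq : ∀ i : ℕ, Nat.card (Quotient (Equiv.Perm.SameCycle.setoid (α ^ i))) =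
      Nat.card (Quotient (Equiv.Perm.SameCycle.setoid (β ^ i))) := by
    intro i
    have e' : {f : X → F // f ∘ (α ^ i : Equiv.Perm X) = f} ≃
        {f : Y → F // f ∘ (β ^ i : Equiv.Perm Y) = f} :=
      e.subtypeEquiv fun f => by rw [← hpow, e.apply_eq_iff_eq]
    have h := Nat.card_congr
      ((invariantFunctionsEquiv (α ^ i)).symm.trans (e'.trans (invariantFunctionsEquiv (β ^ i))))
    rw [Nat.card_fun, Nat.card_fun] at h
    exact Nat.pow_right_injective hF h
  have hper := numPeriod_eq_of_numCyclesDvd_eq α β (numCyclesDvd_eq_of_card_quotient_eq α β hq)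
  -- Conjugacy makes sense only within one symmetric group, so `β` is transported to `X` along an
  -- arbitrary bijection `I₀`; the conjugating element then corrects `I₀`.
  let β' : Equiv.Perm X := I₀.symm.permCongr β
  have hsemi : ∀ x, β' x = I₀.symm (β (I₀ x)) := fun x => rfl
  have hconj : IsConj α β' := by
    refine isConj_of_numPeriod_eq _ _ fun j => (hper j).trans ?_
    refine (Nat.card_congr (I₀.subtypeEquiv fun x => ?_)).symm
    have : Function.minimalPeriod β' x = Function.minimalPeriod β (I₀ x) := by
      refine Function.minimalPeriod_eq_minimalPeriod_iff.2 fun n => ?_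
      have hs : Function.Semiconj I₀ β' β := fun x => by simp [hsemi]
      constructor
      · intro h; exact h.map hs
      · intro h
        refine I₀.injective ?_
        exact ((hs.iterate_right n) x).trans h
    rw [this]
  obtain ⟨g, hg⟩ := isConj_iff.1 hconj
  refine ⟨g.trans I₀, fun x => ?_⟩
  have h := hsemi (g x)
  rw [← hg] at h
  rw [Equiv.Perm.mul_apply, Equiv.Perm.mul_apply,
    show g⁻¹ (g x) = x from g.symm_apply_apply x] at h
  simp [h]

/-! ### The Hattori–Stallings trace of a bimodule -/

/-- The group of `O`-linear trace functionals `A → F` commuting with `p`-th powers. -/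
def frobeniusTraces (O A F : Type*) [CommRing O] [Ring A] [Algebra O A] [Field F] [Algebra O F]
    (p : ℕ) [Fact p.Prime] [CharP F p] : AddSubgroup (A →ₗ[O] F) where
  carrier := {t | IsFrobeniusTrace p t.toAddMonoidHom}
  zero_mem' := ⟨fun x y => rfl, fun x => (zero_pow (Fact.out : p.Prime).ne_zero).symm⟩
  add_mem' {s t} hs ht := ⟨fun x y => congrArg₂ (· + ·) (hs.map_mul_comm x y) (ht.map_mul_comm x y),
    fun x => (congrArg₂ (· + ·) (hs.map_pow x) (ht.map_pow x)).trans (add_pow_char _ _ p).symm⟩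
  neg_mem' {s} hs := ⟨fun x y => congrArg Neg.neg (hs.map_mul_comm x y),
    fun x => (congrArg Neg.neg (hs.map_pow x)).trans (by
      change -(s x ^ p) = (-s x) ^ p
      rw [neg_pow, neg_one_pow_char, neg_one_mul])⟩

theorem mem_frobeniusTraces {O A F : Type*} [CommRing O] [Ring A] [Algebra O A] [Field F]
    [Algebra O F] {p : ℕ} [Fact p.Prime] [CharP F p] {t : A →ₗ[O] F} :
    t ∈ frobeniusTraces O A F p ↔ IsFrobeniusTrace p t.toAddMonoidHom := Iff.rfl

/-- Composition of a trace functional with an endomorphism of `F`. -/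
def twistTrace {O A F : Type*} [CommRing O] [Ring A] [Algebra O A] [Field F]
    [Algebra O F] {p : ℕ} [Fact p.Prime] [CharP F p] (τ : F →ₐ[O] F) (t : frobeniusTraces O A F p) :
    frobeniusTraces O A F p :=
  ⟨τ.toLinearMap ∘ₗ t.1, fun x y => congrArg τ (t.2.map_mul_comm x y),
    fun x => (congrArg τ (t.2.map_pow x)).trans (map_pow τ _ _)⟩

namespace AlgBimod

section
variable {O : Type u} {A : Type v₁} {B : Type v₂} {C : Type v₃} [CommRing O]
  [Ring A] [Algebra O A] [Ring B] [Algebra O B] [Ring C] [Algebra O C]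

/-- The class of `m ⊗ n` in `M ⊗_B N`. -/
def tmk (M : AlgBimod.{w} O A B) (N : AlgBimod.{w'} O B C) :
    M.carrier →ₗ[O] N.carrier →ₗ[O] (M.tensor N).carrier :=
  (TensorProduct.mk O M.carrier N.carrier).compr₂ (balanced M N).mkQ

theorem op_smul_tmk (M : AlgBimod.{w} O A B) (N : AlgBimod.{w'} O B C) (c : Cᵐᵒᵖ) (m : M.carrier)
    (n : N.carrier) : c • tmk M N m n = tmk M N m (c • n) := rfl

theorem tmk_smul (M : AlgBimod.{w} O A B) (N : AlgBimod.{w'} O B C) (b : Bᵐᵒᵖ) (m : M.carrier)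
    (n : N.carrier) : tmk M N (b • m) n = tmk M N m (unop b • n) :=
  (Submodule.Quotient.eq (balanced M N)).2 (Submodule.subset_span ⟨unop b, m, n, rfl⟩)

theorem tensor_induction {M : AlgBimod.{w} O A B} {N : AlgBimod.{w'} O B C}
    {motive : (M.tensor N).carrier → Prop} (zero : motive 0)
    (add : ∀ x y, motive x → motive y → motive (x + y)) (tmk : ∀ m n, motive (tmk M N m n))
    (z : (M.tensor N).carrier) : motive z := by
  obtain ⟨z, rfl⟩ := Submodule.Quotient.mk_surjective (balanced M N) z
  induction z with
  | zero => exact zero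
  | add x y hx hy => exact add _ _ hx hy
  | tmul m n => exact tmk m n

/-- A dual basis of a bimodule which is finitely generated projective as a right module. -/
structure RightFrame (M : AlgBimod.{w} O A B) where
  /-- the index type -/
  ι : Type
  [fintype : Fintype ι]
  [decEq : DecidableEq ι]
  /-- the generators -/
  x : ι → M.carrier
  /-- the coordinates -/
  f : ι → M.carrier →ₗ[Bᵐᵒᵖ] Bᵐᵒᵖ
  sum_smul : ∀ m, ∑ i, f i m • x i = m

attribute [instance] RightFrame.fintype RightFrame.decEq

/-- The dual basis lemma: split a surjection from a free module of finite rank, and take the images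
of the standard basis and the coordinates of the section. -/
theorem IsPerfect.nonempty_rightFrame {M : AlgBimod.{w} O A B} (h : M.IsPerfect) :
    Nonempty (RightFrame M) := by
  have := h.finite_right
  have := h.projective_right
  obtain ⟨n, f, g, -, -, hfg⟩ := Module.Finite.exists_comp_eq_id_of_projective Bᵐᵒᵖ M.carrier
  refine ⟨{ ι := Fin n
            x := fun i => f (Pi.single i 1)
            f := fun i => LinearMap.proj i ∘ₗ g
            sum_smul := fun m => ?_ }⟩
  conv_rhs => rw [← LinearMap.id_apply (R := Bᵐᵒᵖ) m, ← hfg, LinearMap.comp_apply,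
    ← Finset.univ_sum_single (g m), map_sum]
  refine Finset.sum_congr rfl fun i _ => ?_
  rw [← map_smul, ← Pi.single_smul, smul_eq_mul, mul_one]
  rfl

/-! ### Functoriality of the Hattori–Stallings trace -/

namespace RightFrame

variable {F : Type*} [Field F] [Algebra O F]

/-- The functional `a ↦ t (Tr a)` on `A` induced by a functional `t` on `B`. -/
def trace {M : AlgBimod.{w} O A B} (D : RightFrame M) (t : B →ₗ[O] F) : A →ₗ[O] F :=
  ∑ i, t ∘ₗ (opLinearEquiv O).symm.toLinearMap ∘ₗ (D.f i).restrictScalars O ∘ₗ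
    LinearMap.applyₗ (D.x i) ∘ₗ M.lact.toLinearMap

theorem trace_apply {M : AlgBimod.{w} O A B} (D : RightFrame M) (t : B →ₗ[O] F) (a : A) :
    D.trace t a = ∑ i, t (unop (D.f i (a • D.x i))) := by
  simp [trace, lact_apply]

theorem trace_sub {M : AlgBimod.{w} O A B} (D : RightFrame M) (s t : B →ₗ[O] F) :
    D.trace (s - t) = D.trace s - D.trace t := by
  ext a
  simp [trace_apply]

theorem trace_comp {M : AlgBimod.{w} O A B} (D : RightFrame M) (τ : F →ₐ[O] F) (t : B →ₗ[O] F) :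
    D.trace (τ.toLinearMap ∘ₗ t) = τ.toLinearMap ∘ₗ D.trace t := by
  ext a
  simp [trace_apply]

/-- The matrix of the action of `a`. -/
def toMatrix {M : AlgBimod.{w} O A B} (D : RightFrame M) : A →+ Matrix D.ι D.ι B where
  toFun a := Matrix.of fun i j => unop (D.f i (a • D.x j))
  map_zero' := by ext; simp
  map_add' a b := by ext; simp [add_smul]

/-- Insert the dual basis expansion of b • x_j. The generators need not be a basis, so 1 may go to a
proper idempotent matrix. -/
theorem toMatrix_mul {M : AlgBimod.{w} O A B} (D : RightFrame M) (a b : A) :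
    D.toMatrix (a * b) = D.toMatrix a * D.toMatrix b := by
  ext i j
  simp only [toMatrix, AddMonoidHom.coe_mk, ZeroHom.coe_mk, Matrix.of_apply, Matrix.mul_apply]
  conv_lhs => rw [mul_smul, ← D.sum_smul (b • D.x j), Finset.smul_sum, map_sum]
  rw [Finset.unop_sum]
  refine Finset.sum_congr rfl fun k _ => ?_
  rw [smul_comm, map_smul, smul_eq_mul, unop_mul]

variable {p : ℕ} [Fact p.Prime] [CharP F p]

theorem trace_mem {M : AlgBimod.{w} O A B} (D : RightFrame M) {t : B →ₗ[O] F}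
    (ht : t ∈ frobeniusTraces O B F p) : D.trace t ∈ frobeniusTraces O A F p := by
  have h := (IsFrobeniusTrace.matrix (ι := D.ι) (mem_frobeniusTraces.1 ht)).comp D.toMatrix
    D.toMatrix_mul (Fact.out : p.Prime).ne_zero
  rw [mem_frobeniusTraces]
  convert h using 1
  ext a
  simp [trace_apply, Matrix.trace, toMatrix]

/-- Expanding each frame in terms of the other gives rectangular matrices P and Q for which the two
traces are t(tr(PQ)) and t(tr(QP)). -/
theorem trace_eq {M : AlgBimod.{w} O A B} (D E : RightFrame M) (t : B →ₗ[O] F)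
    (ht : ∀ x y, t (x * y) = t (y * x)) : D.trace t = E.trace t := by
  ext a
  rw [trace_apply, trace_apply]
  have h1 : ∀ i, t (unop (D.f i (a • D.x i))) =
      ∑ j, t (unop (D.f i (a • E.x j)) * unop (E.f j (D.x i))) := by
    intro i
    rw [← map_sum]
    congr 1
    conv_lhs => rw [← E.sum_smul (D.x i), Finset.smul_sum, map_sum, Finset.unop_sum]
    refine Finset.sum_congr rfl fun j _ => ?_
    rw [smul_comm, map_smul, smul_eq_mul, unop_mul]
  have h2 : ∀ j, t (unop (E.f j (a • E.x j))) =
      ∑ i, t (unop (E.f j (D.x i)) * unop (D.f i (a • E.x j))) := by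
    intro j
    rw [← map_sum]
    congr 1
    conv_lhs => rw [← D.sum_smul (a • E.x j), map_sum, Finset.unop_sum]
    refine Finset.sum_congr rfl fun i _ => ?_
    rw [map_smul, smul_eq_mul, unop_mul]
  rw [Finset.sum_congr rfl fun i _ => h1 i, Finset.sum_congr rfl fun j _ => h2 j, Finset.sum_comm]
  exact Finset.sum_congr rfl fun j _ => Finset.sum_congr rfl fun i _ => ht _ _

theorem exists_trace_eq_of_iso {M : AlgBimod.{w} O A B} {N : AlgBimod.{w'} O A B}
    (E : RightFrame N) (h : M.Iso N) :
    ∃ D : RightFrame M, ∀ t : B →ₗ[O] F, D.trace t = E.trace t := by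
  obtain ⟨e, he1, he2⟩ := h
  have he2' : ∀ (b : Bᵐᵒᵖ) (n : N.carrier), e.symm (b • n) = b • e.symm n := by
    intro b n
    rw [LinearEquiv.symm_apply_eq, ← op_unop b, he2, LinearEquiv.apply_symm_apply]
  let e' : M.carrier →ₗ[Bᵐᵒᵖ] N.carrier :=
    { toFun := e
      map_add' := map_add e
      map_smul' := fun b m => he2 b.unop m }
  refine ⟨{ ι := E.ι
            x := fun j => e.symm (E.x j)
            f := fun j => E.f j ∘ₗ e'
            sum_smul := fun m => ?_ }, fun t => ?_⟩
  · conv_rhs => rw [← e.symm_apply_apply m, ← E.sum_smul (e m), map_sum]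
    exact Finset.sum_congr rfl fun j _ => (he2' _ _).symm
  · ext a
    rw [trace_apply, trace_apply]
    refine Finset.sum_congr rfl fun j _ => ?_
    change t (unop (E.f j (e (a • e.symm (E.x j))))) = _
    rw [he1, e.apply_symm_apply]

theorem trace_eq_of_iso {M : AlgBimod.{w} O A B} {N : AlgBimod.{w'} O A B} (D : RightFrame M)
    (E : RightFrame N) (h : M.Iso N) (t : B →ₗ[O] F) (ht : ∀ x y, t (x * y) = t (y * x)) :
    D.trace t = E.trace t := by
  obtain ⟨D', hD'⟩ := exists_trace_eq_of_iso (F := F) E h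
  rw [← hD', trace_eq D D' t ht]

/-- The dual basis of a direct sum. -/
def sum {M : AlgBimod.{w} O A B} {N : AlgBimod.{w'} O A B} (D : RightFrame M)
    (E : RightFrame N) : RightFrame (M.sum N) where
  ι := D.ι ⊕ E.ι
  x := Sum.elim (fun i => (D.x i, 0)) (fun j => (0, E.x j))
  f := Sum.elim (fun i => D.f i ∘ₗ LinearMap.fst _ M.carrier N.carrier)
    (fun j => E.f j ∘ₗ LinearMap.snd _ M.carrier N.carrier)
  sum_smul := fun m => by
    rw [Fintype.sum_sum_type]
    change ∑ i, (D.f i m.1 • (D.x i, (0 : N.carrier))) +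
      ∑ j, (E.f j m.2 • ((0 : M.carrier), E.x j)) = m
    refine Prod.ext ?_ ?_
    · simp [Prod.fst_sum, D.sum_smul]
    · simp [Prod.snd_sum, E.sum_smul]

theorem sum_trace {M : AlgBimod.{w} O A B} {N : AlgBimod.{w'} O A B} (D : RightFrame M)
    (E : RightFrame N) (t : B →ₗ[O] F) : (D.sum E).trace t = D.trace t + E.trace t := by
  ext a
  rw [LinearMap.add_apply, trace_apply, trace_apply, trace_apply]
  exact Fintype.sum_sum_type _

/-- The dual basis of the zero bimodule. -/
def zero : RightFrame (AlgBimod.zero.{w} O A B) where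
  ι := Empty
  x := Empty.elim
  f := Empty.elim
  sum_smul := fun _ => rfl

theorem zero_trace (t : B →ₗ[O] F) : (zero.{w} : RightFrame (.zero O A B)).trace t = 0 := by
  ext a
  rw [trace_apply]
  rfl

/-- The dual basis of the regular bimodule. -/
def regular : RightFrame (AlgBimod.regular O A) where
  ι := Unit
  x := fun _ => (1 : A)
  f := fun _ =>
    { toFun := fun a : A => op a
      map_add' := fun _ _ => rfl
      map_smul' := fun _ _ => rfl }
  sum_smul := fun m => (Finset.sum_const _).trans ((one_smul ℕ _).trans (one_mul (M := A) m))

theorem regular_trace (t : A →ₗ[O] F) : (regular : RightFrame (.regular O A)).trace t = t := by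
  ext a
  rw [trace_apply]
  change ∑ _i : Unit, t (a * 1) = t a
  simp

/-- The coordinate functions on a tensor product. -/
def tensorCoord {M : AlgBimod.{w} O A B} {N : AlgBimod.{w'} O B C} (D : RightFrame M)
    (E : RightFrame N) (i : D.ι) (j : E.ι) : (M.tensor N).carrier →ₗ[Cᵐᵒᵖ] Cᵐᵒᵖ :=
  letI φ : (M.carrier ⊗[O] N.carrier) ⧸ balanced M N →ₗ[O] Cᵐᵒᵖ :=
    (balanced M N).liftQ (TensorProduct.lift
      ((LinearMap.llcomp O N.carrier N.carrier Cᵐᵒᵖ ((E.f j).restrictScalars O)) ∘ₗ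
        N.lact.toLinearMap ∘ₗ (opLinearEquiv O).symm.toLinearMap ∘ₗ (D.f i).restrictScalars O)) (by
      refine Submodule.span_le.2 ?_
      rintro _ ⟨b, m, n, rfl⟩
      simp [lact_apply])
  { toFun := φ
    map_add' := map_add φ
    map_smul' := by
      intro c z
      have h : φ ∘ₗ tensorRight M N c = LinearMap.mulLeft O c ∘ₗ φ := by
        apply Submodule.linearMap_qext
        apply TensorProduct.ext'
        intro m n
        change E.f j (unop (D.f i m) • c • n) = c * E.f j (unop (D.f i m) • n)
        rw [smul_comm, map_smul, smul_eq_mul]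
      exact LinearMap.congr_fun h z }

theorem tensorCoord_tmk {M : AlgBimod.{w} O A B} {N : AlgBimod.{w'} O B C} (D : RightFrame M)
    (E : RightFrame N) (i : D.ι) (j : E.ι) (m : M.carrier) (n : N.carrier) :
    tensorCoord D E i j (tmk M N m n) = E.f j (unop (D.f i m) • n) := rfl

/-- The dual basis of a tensor product. -/
def tensor {M : AlgBimod.{w} O A B} {N : AlgBimod.{w'} O B C} (D : RightFrame M)
    (E : RightFrame N) : RightFrame (M.tensor N) where
  ι := D.ι × E.ι
  x := fun q => tmk M N (D.x q.1) (E.x q.2)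
  f := fun q => tensorCoord D E q.1 q.2
  sum_smul := fun z => by
    induction z using tensor_induction with
    | zero => simp
    | add x y hx hy =>
      conv_rhs => rw [← hx, ← hy]
      simp [add_smul, Finset.sum_add_distrib]
    | tmk m n =>
      simp only [Fintype.sum_prod_type, tensorCoord_tmk, op_smul_tmk, ← map_sum, E.sum_smul,
        ← tmk_smul]
      rw [← LinearMap.sum_apply, ← map_sum, D.sum_smul]

/-- Coordinates on the product frame are coordinates for `E` after coordinates for `D`, so the trace
of the tensor product is an iterated trace. This makes the product of virtual bimodules act by
composition. -/
theorem tensor_trace {M : AlgBimod.{w} O A B} {N : AlgBimod.{w'} O B C} (D : RightFrame M)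
    (E : RightFrame N) (t : C →ₗ[O] F) : (D.tensor E).trace t = D.trace (E.trace t) := by
  ext a
  rw [trace_apply, trace_apply]
  simp only [trace_apply]
  exact Fintype.sum_prod_type _

/-- The action of a virtual bimodule on trace functionals. -/
def virtualTrace {M N : AlgBimod.{w} O A B} (D : RightFrame M) (E : RightFrame N)
    (t : frobeniusTraces O B F p) : frobeniusTraces O A F p :=
  ⟨D.trace t.1 - E.trace t.1, sub_mem (D.trace_mem t.2) (E.trace_mem t.2)⟩

theorem virtualTrace_twist {M N : AlgBimod.{w} O A B} (D : RightFrame M) (E : RightFrame N)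
    (τ : F →ₐ[O] F) (t : frobeniusTraces O B F p) :
    virtualTrace D E (twistTrace τ t) = twistTrace τ (virtualTrace D E t) := by
  apply Subtype.ext
  simp only [virtualTrace, twistTrace, trace_comp, LinearMap.comp_sub]

/-- Equality of classes is an isomorphism after adding `W`. Taking traces on both sides turns it
into an identity in the group of functionals, where the contribution of `W` cancels and the regular
bimodule acts as the identity. -/
theorem virtualTrace_virtualTrace {X : VirtualBimod.{w} O A B} {Y : VirtualBimod.{w'} O B A}
    (D : RightFrame X.pos) (E : RightFrame X.neg) (D' : RightFrame Y.pos) (E' : RightFrame Y.neg)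
    (h : (X.mul Y).ClassEq (.of (.regular O A))) (t : frobeniusTraces O A F p) :
    virtualTrace D E (virtualTrace D' E' t) = t := by
  obtain ⟨W, hW, hiso⟩ := h
  obtain ⟨V⟩ := hW.nonempty_rightFrame
  have h1 := trace_eq_of_iso ((((D.tensor D').sum (E.tensor E')).sum zero).sum V)
    ((regular.sum ((D.tensor E').sum (E.tensor D'))).sum V) hiso t.1 t.2.map_mul_comm
  simp only [sum_trace, zero_trace, regular_trace, tensor_trace] at h1
  apply Subtype.ext
  simp only [virtualTrace, trace_sub]
  have h2 := add_right_cancel h1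
  rw [add_zero] at h2
  rw [eq_comm, ← sub_eq_zero] at h2 ⊢
  rw [← h2]
  abel

end RightFrame

end

end AlgBimod

theorem VirtualBimod.InducesVirtualMorita.exists_equiv_frobeniusTraces {O : Type u} {A : Type v₁}
    {B : Type v₂} [CommRing O] [Ring A] [Algebra O A] [Ring B] [Algebra O B]
    {X : VirtualBimod.{w} O A B} {Y : VirtualBimod.{w'} O B A} (h : X.InducesVirtualMorita Y)
    (F : Type*) [Field F] [Algebra O F] (p : ℕ) [Fact p.Prime] [CharP F p] :
    ∃ e : frobeniusTraces O A F p ≃ frobeniusTraces O B F p,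
      ∀ τ t, e (twistTrace τ t) = twistTrace τ (e t) := by
  obtain ⟨D⟩ := h.perfect_left.pos.nonempty_rightFrame
  obtain ⟨E⟩ := h.perfect_left.neg.nonempty_rightFrame
  obtain ⟨D'⟩ := h.perfect_right.pos.nonempty_rightFrame
  obtain ⟨E'⟩ := h.perfect_right.neg.nonempty_rightFrame
  open AlgBimod.RightFrame in
  exact ⟨⟨virtualTrace D' E', virtualTrace D E, virtualTrace_virtualTrace D E D' E' h.mul_left,
    virtualTrace_virtualTrace D' E' D E h.mul_right⟩, virtualTrace_twist D' E'⟩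

/-! ### Simple modules of a group algebra over an algebraically closed field -/

/-- Wedderburn–Artin for R modulo its Jacobson radical; over an algebraically closed field no other
division algebra occurs. -/
theorem exists_surjective_pi_matrix (F R : Type*) [Field F] [IsAlgClosed F] [Ring R] [Algebra F R]
    [FiniteDimensional F R] :
    ∃ (l : ℕ) (d : Fin l → ℕ) (q : R →ₐ[F] Π i, Matrix (Fin (d i)) (Fin (d i)) F),
      (∀ i, NeZero (d i)) ∧ Function.Surjective q ∧ ∀ x, q x = 0 → x ∈ Ring.jacobson R := by
  have := IsArtinianRing.of_finite F R
  have : FiniteDimensional F (R ⧸ Ring.jacobson R) :=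
    Module.Finite.of_surjective (Ideal.Quotient.mkₐ F (Ring.jacobson R)).toLinearMap
      Ideal.Quotient.mk_surjective
  obtain ⟨l, d, hd, ⟨e⟩⟩ :=
    IsSemisimpleRing.exists_algEquiv_pi_matrix_of_isAlgClosed F (R ⧸ Ring.jacobson R)
  refine ⟨l, d, e.toAlgHom.comp (Ideal.Quotient.mkₐ F (Ring.jacobson R)), hd,
    e.surjective.comp Ideal.Quotient.mk_surjective, fun x hx => ?_⟩
  exact Ideal.Quotient.eq_zero_iff_mem.1 ((map_eq_zero_iff e e.injective).1 hx)

theorem isNilpotent_of_mem_jacobson {R : Type*} [Ring R] [IsArtinianRing R] {x : R}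
    (hx : x ∈ Ring.jacobson R) : IsNilpotent x := by
  obtain ⟨n, hn⟩ := IsSemiprimaryRing.isNilpotent (R := R)
  exact ⟨n, by simpa [hn] using Ideal.pow_mem_pow hx n⟩

section
variable {F : Type*} [Field F] {G : Type*} [Group G] {V : Type*} [AddCommGroup V] [Module F V]

theorem Representation.isIrreducible_iff_forall (ρ : Representation F G V) :
    ρ.IsIrreducible ↔ Nontrivial V ∧
      ∀ U : Submodule F V, (∀ g, ∀ v ∈ U, ρ g v ∈ U) → U = ⊥ ∨ U = ⊤ := by
  constructor
  · intro h
    refine ⟨?_, fun U hU => ?_⟩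
    · by_contra hV
      rw [not_nontrivial_iff_subsingleton] at hV
      exact bot_ne_top (α := Subrepresentation ρ)
        (Subrepresentation.toSubmodule_injective (Subsingleton.elim _ _))
    · exact (eq_bot_or_eq_top (⟨U, fun g v => hU g v⟩ : Subrepresentation ρ)).imp
        (congrArg Subrepresentation.toSubmodule) (congrArg Subrepresentation.toSubmodule)
  · rintro ⟨hV, h⟩
    refine { exists_pair_ne := ⟨⊥, ⊤, fun hbt => ?_⟩, eq_bot_or_eq_top := fun U => ?_ }
    · exact bot_ne_top (α := Submodule F V) (congrArg Subrepresentation.toSubmodule hbt)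
    · exact (h U.toSubmodule fun g v => U.apply_mem_toSubmodule g (v := v)).imp
        (fun h => Subrepresentation.toSubmodule_injective h)
        (fun h => Subrepresentation.toSubmodule_injective h)

theorem Representation.asAlgebraHom_mem_of_stable (ρ : Representation F G V) (U : Submodule F V)
    (hU : ∀ g, ∀ v ∈ U, ρ g v ∈ U) (r : MonoidAlgebra F G) {v : V} (hv : v ∈ U) :
    ρ.asAlgebraHom r v ∈ U := by
  induction r using MonoidAlgebra.induction_linear with
  | zero => simp
  | add x y hx hy => rw [map_add]; exact U.add_mem hx hy
  | single g a => rw [asAlgebraHom_single]; exact U.smul_mem a (hU g v hv)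

theorem Representation.IsIrreducible.asAlgebraHom_eq_zero {ρ : Representation F G V}
    (h : ρ.IsIrreducible) {r : MonoidAlgebra F G} (hr : r ∈ Ring.jacobson (MonoidAlgebra F G)) :
    ρ.asAlgebraHom r = 0 := by
  have := (Representation.irreducible_iff_isSimpleModule_asModule ρ).1 h
  have h1 := IsSemisimpleModule.jacobson_le_annihilator (MonoidAlgebra F G) ρ.asModule hr
  ext v
  exact Module.mem_annihilator.1 h1 v

theorem exists_mulVec_eq {F ι : Type*} [Field F] [Fintype ι] [DecidableEq ι] {x : ι → F}
    (hx : x ≠ 0) (y : ι → F) : ∃ N : Matrix ι ι F, N.mulVec x = y := by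
  obtain ⟨b, hb⟩ := Function.ne_iff.1 hx
  refine ⟨Matrix.vecMulVec y (Pi.single b (x b)⁻¹), ?_⟩
  rw [Matrix.vecMulVec_mulVec]
  have : (x b)⁻¹ * x b = 1 := inv_mul_cancel₀ hb
  simp [this]

end

/-- A semisimple quotient of the group algebra with nilpotent kernel. -/
structure SemisimpleQuotient (F : Type*) [Field F] (G : Type*) [Group G] where
  /-- the number of simple modules -/
  l : ℕ
  /-- the dimensions of the simple modules -/
  d : Fin l → ℕ
  /-- the quotient map -/
  q : MonoidAlgebra F G →ₐ[F] Π i, Matrix (Fin (d i)) (Fin (d i)) F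
  d_ne_zero : ∀ i, NeZero (d i)
  surjective : Function.Surjective q
  mem_jacobson : ∀ x, q x = 0 → x ∈ Ring.jacobson (MonoidAlgebra F G)

attribute [instance] SemisimpleQuotient.d_ne_zero

namespace SemisimpleQuotient

variable {F : Type*} [Field F] {G : Type*} [Group G]

theorem nonempty [IsAlgClosed F] [Finite G] : Nonempty (SemisimpleQuotient F G) := by
  have : FiniteDimensional F (MonoidAlgebra F G) := inferInstance
  obtain ⟨l, d, q, h1, h2, h3⟩ := exists_surjective_pi_matrix F (MonoidAlgebra F G)
  exact ⟨l, d, q, h1, h2, h3⟩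

variable (Q : SemisimpleQuotient F G)

/-- The `i`-th simple module. -/
def rep (i : Fin Q.l) : Representation F G (Fin (Q.d i) → F) :=
  (Matrix.toLinAlgEquiv' (R := F)).toAlgHom.toRingHom.toMonoidHom.comp
    (((Pi.evalAlgHom F _ i).comp Q.q).toRingHom.toMonoidHom.comp (MonoidAlgebra.of F G))

theorem rep_asAlgebraHom (i : Fin Q.l) (r : MonoidAlgebra F G) :
    (Q.rep i).asAlgebraHom r = Matrix.toLin' (Q.q r i) := by
  have : (Q.rep i).asAlgebraHom =
      (Matrix.toLinAlgEquiv' (R := F)).toAlgHom.comp ((Pi.evalAlgHom F _ i).comp Q.q) := by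
    refine MonoidAlgebra.algHom_ext (fun g => ?_) (Subsingleton.elim _ _)
    rw [Representation.asAlgebraHom_single_one]
    rfl
  rw [this]
  rfl

theorem rep_isIrreducible (i : Fin Q.l) : (Q.rep i).IsIrreducible := by
  rw [Representation.isIrreducible_iff_forall]
  refine ⟨inferInstance, fun U hU => or_iff_not_imp_left.2 fun hbot => ?_⟩
  obtain ⟨x, hxU, hx⟩ := (Submodule.ne_bot_iff U).1 hbot
  refine (Submodule.eq_top_iff').2 fun y => ?_
  obtain ⟨N, rfl⟩ := exists_mulVec_eq hx y
  obtain ⟨r, hr⟩ := Q.surjective (Pi.single i N)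
  have := (Q.rep i).asAlgebraHom_mem_of_stable U hU r hxU
  rwa [rep_asAlgebraHom, hr, Pi.single_eq_same, Matrix.toLin'_apply] at this

/-- Every simple module of the group algebra occurs in its semisimple quotient. -/
theorem exists_equiv_rep {V : Type*} [AddCommGroup V] [Module F V] {ρ : Representation F G V}
    (h : ρ.IsIrreducible) : ∃ (i : Fin Q.l) (e : (Fin (Q.d i) → F) ≃ₗ[F] V),
      ∀ r, ρ.asAlgebraHom r = e.conj ((Q.rep i).asAlgebraHom r) := by
  obtain ⟨hV, hU⟩ := ρ.isIrreducible_iff_forall.1 h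
  -- An irreducible representation kills the Jacobson radical, hence factors through the product of
  -- matrix algebras.
  let Φ : (Π i, Matrix (Fin (Q.d i)) (Fin (Q.d i)) F) →+* Module.End F V :=
    Q.q.toRingHom.liftOfSurjective Q.surjective ⟨ρ.asAlgebraHom.toRingHom, fun x hx =>
      h.asAlgebraHom_eq_zero (Q.mem_jacobson x hx)⟩
  have hΦ : ∀ r, Φ (Q.q r) = ρ.asAlgebraHom r :=
    Q.q.toRingHom.liftOfRightInverse_comp_apply _ _ _
  have hΦs : ∀ (a : F) M, Φ (a • M) = a • Φ M := by
    intro a M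
    obtain ⟨r, rfl⟩ := Q.surjective M
    rw [← map_smul, hΦ, hΦ, map_smul]
  obtain ⟨v, hv⟩ := exists_ne (0 : V)
  -- The diagonal matrix units of all blocks sum to 1, so one of them does not kill `v`.
  obtain ⟨i, a, hw⟩ : ∃ i, ∃ a, Φ (Pi.single i (Matrix.single a a 1)) v ≠ 0 := by
    by_contra! hall
    apply hv
    have h1 : (1 : Π i, Matrix (Fin (Q.d i)) (Fin (Q.d i)) F) =
        ∑ i, ∑ a, Pi.single i (Matrix.single a a 1) := by
      rw [← Finset.univ_sum_single (1 : Π i, Matrix (Fin (Q.d i)) (Fin (Q.d i)) F)]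
      refine Finset.sum_congr rfl fun i _ => ?_
      have h2 : (1 : Matrix (Fin (Q.d i)) (Fin (Q.d i)) F) = ∑ a, Matrix.single a a 1 := by
        rw [Matrix.sum_single_eq_diagonal]; rfl
      rw [Pi.one_apply, h2]
      exact map_sum (AddMonoidHom.single (fun i => Matrix (Fin (Q.d i)) (Fin (Q.d i)) F) i) _ _
    have h3 : Φ 1 v = v := by rw [map_one]; rfl
    rw [← h3, h1]
    simp [map_sum, LinearMap.sum_apply, hall]
  obtain ⟨w, hwv⟩ : ∃ w, Φ (Pi.single i (Matrix.single a a 1)) v = w := ⟨_, rfl⟩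
  rw [hwv] at hw
  -- The a-th columns of the i-th block form a copy of the i-th simple module, mapped to V by acting
  -- on `w`. As `w` is fixed by the chosen matrix unit, `L` sends the a-th basis vector to `w`;
  -- Schur's argument then makes it bijective.
  let L : (Fin (Q.d i) → F) →ₗ[F] V :=
    { toFun := fun x => Φ (Pi.single i (Matrix.vecMulVec x (Pi.single a 1))) w
      map_add' := fun x y => by
        rw [Matrix.add_vecMulVec, Pi.single_add, map_add]; rfl
      map_smul' := fun c x => by
        rw [Matrix.smul_vecMulVec, Pi.single_smul, hΦs]; rfl }
  have hL : ∀ r x, L ((Q.q r i).mulVec x) = ρ.asAlgebraHom r (L x) := by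
    intro r x
    change Φ _ w = ρ.asAlgebraHom r (Φ _ w)
    rw [← hΦ, ← Module.End.mul_apply, ← map_mul, ← Matrix.mul_vecMulVec]
    congr 2
    funext j
    obtain rfl | hj := eq_or_ne j i
    · simp
    · simp [Pi.single_eq_of_ne hj]
  have hLa : L (Pi.single a 1) ≠ 0 := by
    have : L (Pi.single a 1) = w := by
      change Φ _ w = w
      rw [← hwv, ← Module.End.mul_apply, ← map_mul, ← Pi.single_mul, ← Matrix.single_eq_single_vecMulVec_single,
        Matrix.single_mul_single_same, one_mul]
    rwa [this]
  have hinj : Function.Injective L := by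
    rw [← LinearMap.ker_eq_bot, Submodule.eq_bot_iff]
    intro x hx
    by_contra hx0
    obtain ⟨N, hN⟩ := exists_mulVec_eq hx0 (Pi.single a 1)
    obtain ⟨r, hr⟩ := Q.surjective (Pi.single i N)
    have := hL r x
    rw [hr, Pi.single_eq_same, hN, LinearMap.mem_ker.1 hx, map_zero] at this
    exact hLa this
  have hsurj : Function.Surjective L := by
    rw [← LinearMap.range_eq_top]
    refine (hU _ ?_).resolve_left fun hbot => hLa ?_
    · rintro g _ ⟨x, rfl⟩
      refine ⟨(Q.q (MonoidAlgebra.of F G g) i).mulVec x, ?_⟩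
      rw [hL, Representation.asAlgebraHom_of]
    · rw [LinearMap.range_eq_bot.1 hbot]; rfl
  refine ⟨i, LinearEquiv.ofBijective L ⟨hinj, hsurj⟩, fun r => ?_⟩
  ext x
  obtain ⟨y, rfl⟩ := (LinearEquiv.ofBijective L ⟨hinj, hsurj⟩).surjective x
  rw [LinearEquiv.conj_apply_apply, LinearEquiv.symm_apply_apply, rep_asAlgebraHom,
    Matrix.toLin'_apply]
  exact (hL r y).symm

end SemisimpleQuotient

/-! ### Lifting roots of unity and existence of Brauer characters -/

section
variable {O : Type u} [CommRing O] {L : Type w} [Field L] [Algebra O L]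
  {F : Type w'} [Field F] [Algebra O F] {p : ℕ} [Fact p.Prime] [CharP F p]

/-- Put y = z/w, so y reduces to 1 and (y - 1)(1 + y + ... + y^(m-1)) = 0 in a domain. The second
factor reduces to m, which is nonzero in `F`, so y = 1. -/
theorem reduction_injOn_roots (π : integralClosure O L →ₐ[O] F) {m : ℕ} (hm : p.Coprime m)
    {z w : integralClosure O L} (hz : z ^ m = 1) (hw : w ^ m = 1) (h : π z = π w) : z = w := by
  have hm0 : m ≠ 0 := by
    rintro rfl
    exact (Fact.out : p.Prime).one_lt.ne' (by simpa using hm)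
  set y := z * w ^ (m - 1) with hy
  have hwm : w ^ (m - 1) * w = 1 := by rw [← pow_succ, Nat.sub_add_cancel (by omega), hw]
  have hym : y ^ m = 1 := by rw [hy, mul_pow, hz, ← pow_mul, mul_comm (m - 1), pow_mul, hw, one_pow, mul_one]
  have hπ : π y = 1 := by
    rw [hy, map_mul, h, ← map_mul, mul_comm, hwm, map_one]
  have h1 : (y - 1) * ∑ i ∈ Finset.range m, y ^ i = 0 := by
    rw [mul_geom_sum, hym, sub_self]
  rcases mul_eq_zero.1 h1 with h2 | h2
  · calc z = z * (w ^ (m - 1) * w) := by rw [hwm, mul_one]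
      _ = y * w := by rw [hy, mul_assoc]
      _ = w := by rw [sub_eq_zero.1 h2, one_mul]
  · exfalso
    have h3 := congrArg π h2
    simp only [map_sum, map_pow, hπ, one_pow, Finset.sum_const, Finset.card_range, nsmul_eq_mul,
      mul_one, map_zero] at h3
    rw [CharP.cast_eq_zero_iff F p] at h3
    exact (Fact.out : p.Prime).one_lt.ne' (Nat.eq_one_of_dvd_coprimes hm dvd_rfl h3)

/-- By injectivity a primitive m-th root of unity reduces to a primitive one, whose powers exhaust
the m-th roots of unity of `F`. Outside these roots `ℓ` takes the irrelevant value 0. -/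
theorem exists_lift_roots [CharZero L] [IsAlgClosed L] (π : integralClosure O L →ₐ[O] F) {m : ℕ}
    (hm : p.Coprime m) : ∃ ℓ : F → integralClosure O L,
      (∀ η, η ^ m = 1 → ℓ η ^ m = 1 ∧ π (ℓ η) = η) ∧ ∀ z, z ^ m = 1 → ℓ (π z) = z := by
  have hm0 : m ≠ 0 := by
    rintro rfl
    exact (Fact.out : p.Prime).one_lt.ne' (by simpa using hm)
  have : NeZero m := ⟨hm0⟩
  obtain ⟨ζ, hζ⟩ := HasEnoughRootsOfUnity.exists_primitiveRoot L m
  let ζ' : integralClosure O L := ⟨ζ, IsIntegral.of_pow (Nat.pos_of_ne_zero hm0)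
    (by rw [hζ.pow_eq_one]; exact isIntegral_one)⟩
  have hζ' : IsPrimitiveRoot ζ' m :=
    IsPrimitiveRoot.of_map_of_injective (f := (integralClosure O L).val) hζ Subtype.val_injective
  have hπζ : IsPrimitiveRoot (π ζ') m := by
    refine ⟨by rw [← map_pow, hζ'.pow_eq_one, map_one], fun j hj => hζ'.dvd_of_pow_eq_one j ?_⟩
    refine reduction_injOn_roots π hm ?_ (one_pow m) (by rw [map_pow, hj, map_one])
    rw [← pow_mul, mul_comm, pow_mul, hζ'.pow_eq_one, one_pow]
  have hspec : ∀ η : F, η ^ m = 1 → ∃ z : integralClosure O L, z ^ m = 1 ∧ π z = η := by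
    intro η hη
    obtain ⟨j, -, rfl⟩ := hπζ.eq_pow_of_pow_eq_one hη
    exact ⟨ζ' ^ j, by rw [← pow_mul, mul_comm, pow_mul, hζ'.pow_eq_one, one_pow], map_pow _ _ _⟩
  classical
  refine ⟨fun η => if h : η ^ m = 1 then (hspec η h).choose else 0, fun η hη => ?_, fun z hz => ?_⟩
  · simp only [hη, dif_pos]
    exact (hspec η hη).choose_spec
  · have hη : π z ^ m = 1 := by rw [← map_pow, hz, map_one]
    simp only [hη, dif_pos]
    exact reduction_injOn_roots π hm (hspec _ hη).choose_spec.1 hz (hspec _ hη).choose_spec.2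

variable {G : Type v} [Group G]

theorem pow_orderOf_eq_one_of_mem_roots {V : Type*} [AddCommGroup V] [Module F V]
    [FiniteDimensional F V] (ρ : Representation F G V) (g : G) {η : F}
    (hη : η ∈ (ρ g).charpoly.roots) : η ^ orderOf g = 1 := by
  obtain ⟨v, hv⟩ := ((Module.End.hasEigenvalue_iff_isRoot_charpoly (ρ g) η).2
    (Polynomial.isRoot_of_mem_roots hη)).exists_hasEigenvector
  have h1 := hv.pow_apply (orderOf g)
  rw [← map_pow, pow_orderOf_eq_one, map_one, Module.End.one_apply] at h1
  have h2 : (η ^ orderOf g - 1) • v = 0 := by rw [sub_smul, one_smul, ← h1, sub_self]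
  exact sub_eq_zero.1 ((smul_eq_zero.1 h2).resolve_right hv.2)

omit [Fact p.Prime] [CharP F p] in
-- The coercion in the definition is read as a monadic lift of the whole multiset `s` to `L`
-- followed by the identity map; here it becomes an ordinary `Multiset.map`.
theorem isBrauerCharacterOf_iff {π : integralClosure O L →ₐ[O] F} {d : ℕ}
    {ρ : Representation F G (Fin d → F)} {φ : PRegular p G → L} :
    IsBrauerCharacterOf p π ρ φ ↔ ∀ g : PRegular p G, ∃ s : Multiset (integralClosure O L),
      (∀ z ∈ s, z ^ orderOf g.1 = 1) ∧ s.map π = (ρ g.1).charpoly.roots ∧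
        φ g = (s.map (integralClosure O L).val).sum := by
  have key : ∀ s : Multiset (integralClosure O L),
      ((do let a ← s; pure (a : L) : Multiset L).map fun z => z) =
        s.map (integralClosure O L).val := by
    intro s
    rw [Multiset.map_id']
    simp only [Multiset.bind_def, Multiset.pure_def]
    exact Multiset.bind_singleton _ _
  simp only [IsBrauerCharacterOf, key]

theorem exists_isBrauerCharacterOf [CharZero L] [IsAlgClosed L] (π : integralClosure O L →ₐ[O] F)
    {d : ℕ} (ρ : Representation F G (Fin d → F)) :
    ∃ φ : PRegular p G → L, IsBrauerCharacterOf p π ρ φ := by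
  choose ℓ hℓ using fun g : PRegular p G => exists_lift_roots π g.2
  refine ⟨fun g => (((ρ g.1).charpoly.roots.map (ℓ g)).map (integralClosure O L).val).sum,
    isBrauerCharacterOf_iff.2 fun g =>
    ⟨(ρ g.1).charpoly.roots.map (ℓ g), fun z hz => ?_, ?_, rfl⟩⟩
  · obtain ⟨η, hη, rfl⟩ := Multiset.mem_map.1 hz
    exact ((hℓ g).1 η (pow_orderOf_eq_one_of_mem_roots ρ g.1 hη)).1
  · rw [Multiset.map_map]
    conv_rhs => rw [← Multiset.map_id (ρ g.1).charpoly.roots]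
    exact Multiset.map_congr rfl fun η hη =>
      ((hℓ g).1 η (pow_orderOf_eq_one_of_mem_roots ρ g.1 hη)).2

theorem IsBrauerCharacterOf.eq [CharZero L] [IsAlgClosed L] {π : integralClosure O L →ₐ[O] F}
    {d d' : ℕ} {ρ : Representation F G (Fin d → F)} {ρ' : Representation F G (Fin d' → F)}
    {φ φ' : PRegular p G → L} (h : IsBrauerCharacterOf p π ρ φ) (h' : IsBrauerCharacterOf p π ρ' φ')
    (hρ : ∀ g, (ρ g).charpoly.roots = (ρ' g).charpoly.roots) : φ = φ' := by
  funext g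
  obtain ⟨ℓ, -, hℓ⟩ := exists_lift_roots (p := p) π g.2
  obtain ⟨s, hs1, hs2, hs3⟩ := isBrauerCharacterOf_iff.1 h g
  obtain ⟨s', hs1', hs2', hs3'⟩ := isBrauerCharacterOf_iff.1 h' g
  have key : ∀ s : Multiset (integralClosure O L), (∀ z ∈ s, z ^ orderOf g.1 = 1) →
      (s.map π).map ℓ = s := by
    intro s hs
    rw [Multiset.map_map]
    conv_rhs => rw [← Multiset.map_id s]
    exact Multiset.map_congr rfl fun z hz => hℓ z (hs z hz)
  rw [hs3, hs3', ← key s hs1, ← key s' hs1', hs2, hs2', hρ]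

omit [Fact p.Prime] [CharP F p] in
theorem IsBrauerCharacterOf.congr {π : integralClosure O L →ₐ[O] F}
    {d d' : ℕ} {ρ : Representation F G (Fin d → F)} {ρ' : Representation F G (Fin d' → F)}
    {φ : PRegular p G → L} (h : IsBrauerCharacterOf p π ρ φ)
    (hρ : ∀ g, (ρ g).charpoly.roots = (ρ' g).charpoly.roots) : IsBrauerCharacterOf p π ρ' φ := by
  intro g
  obtain ⟨s, hs1, hs2, hs3⟩ := h g
  exact ⟨s, hs1, hs2.trans (hρ g.1), hs3⟩

omit [Fact p.Prime] [CharP F p] in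
-- Reducing the sum of the lifted eigenvalues gives the sum of the eigenvalues. This is the link
-- between Brauer characters and `F`-valued traces.
theorem IsBrauerCharacterOf.exists_reduction_eq_trace [IsAlgClosed F]
    {π : integralClosure O L →ₐ[O] F} {d : ℕ} {ρ : Representation F G (Fin d → F)}
    {φ : PRegular p G → L} (h : IsBrauerCharacterOf p π ρ φ) (g : PRegular p G) :
    ∃ z : integralClosure O L, (z : L) = φ g ∧ π z = LinearMap.trace F _ (ρ g.1) := by
  obtain ⟨s, hs1, hs2, hs3⟩ := isBrauerCharacterOf_iff.1 h g
  refine ⟨s.sum, ?_, ?_⟩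
  · rw [hs3]
    exact map_multiset_sum (integralClosure O L).val s
  · rw [map_multiset_sum, hs2,
      Module.End.trace_eq_sum_roots_charpoly_of_splits (IsAlgClosed.splits _)]

/-! ### Galois twists of representations -/

/-- Application of a field automorphism to the matrix entries of an endomorphism. -/
def twistEnd (τ : F ≃ₐ[O] F) (d : ℕ) : Module.End F (Fin d → F) →+* Module.End F (Fin d → F) :=
  (Matrix.toLinAlgEquiv' (R := F) (n := Fin d)).toRingEquiv.toRingHom.comp
    ((τ : F →+* F).mapMatrix.comp
      (LinearMap.toMatrixAlgEquiv' (R := F) (n := Fin d)).toRingEquiv.toRingHom)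

theorem twistEnd_eq (τ : F ≃ₐ[O] F) {d : ℕ} (f : Module.End F (Fin d → F)) :
    twistEnd τ d f = Matrix.toLin' ((LinearMap.toMatrix' f).map τ) := rfl

theorem twistEnd_apply_comp (τ : F ≃ₐ[O] F) {d : ℕ} (f : Module.End F (Fin d → F)) (v : Fin d → F) :
    twistEnd τ d f (τ ∘ v) = τ ∘ f v := by
  rw [twistEnd_eq, Matrix.toLin'_apply]
  conv_rhs => rw [← Matrix.toLin'_toMatrix' f, Matrix.toLin'_apply]
  exact funext fun i => ((τ : F →+* F).map_mulVec _ _ i).symm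

theorem trace_twistEnd (τ : F ≃ₐ[O] F) {d : ℕ} (f : Module.End F (Fin d → F)) :
    LinearMap.trace F _ (twistEnd τ d f) = τ (LinearMap.trace F _ f) := by
  rw [twistEnd_eq, Matrix.trace_toLin'_eq]
  conv_rhs => rw [← Matrix.toLin'_toMatrix' f, Matrix.trace_toLin'_eq]
  simp [Matrix.trace]

theorem roots_charpoly_twistEnd [IsAlgClosed F] (τ : F ≃ₐ[O] F) {d : ℕ}
    (f : Module.End F (Fin d → F)) :
    (twistEnd τ d f).charpoly.roots = f.charpoly.roots.map τ := by
  rw [twistEnd_eq, Matrix.charpoly_toLin']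
  conv_rhs => rw [← Matrix.toLin'_toMatrix' f, Matrix.charpoly_toLin']
  exact (congrArg Polynomial.roots (Matrix.charpoly_map _ (τ : F →+* F))).trans
    ((IsAlgClosed.splits _).roots_map (τ : F →+* F))

theorem twistEnd_smul (τ : F ≃ₐ[O] F) {d : ℕ} (a : O) (f : Module.End F (Fin d → F)) :
    twistEnd τ d (algebraMap O F a • f) = algebraMap O F a • twistEnd τ d f := by
  rw [twistEnd_eq, twistEnd_eq, map_smul, ← map_smul]
  ext i j
  simp

/-- The Galois twist of a matrix representation. -/
def twistRep (τ : F ≃ₐ[O] F) {d : ℕ} (ρ : Representation F G (Fin d → F)) :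
    Representation F G (Fin d → F) :=
  (twistEnd τ d).toMonoidHom.comp ρ

theorem twistRep_apply (τ : F ≃ₐ[O] F) {d : ℕ} (ρ : Representation F G (Fin d → F)) (g : G) :
    twistRep τ ρ g = twistEnd τ d (ρ g) := rfl

/-- `τ` fixes the image of `O`, so the formula holds for elements with coefficients from `O`. In
particular a twist stays in the same block. -/
theorem twistRep_asAlgebraHom (τ : F ≃ₐ[O] F) {d : ℕ} (ρ : Representation F G (Fin d → F))
    (x : MonoidAlgebra O G) :
    (twistRep τ ρ).asAlgebraHom (MonoidAlgebra.mapRingHom G (algebraMap O F) x) =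
      twistEnd τ d (ρ.asAlgebraHom (MonoidAlgebra.mapRingHom G (algebraMap O F) x)) := by
  induction x using MonoidAlgebra.induction_linear with
  | zero => simp
  | add x y hx hy => simp only [map_add, hx, hy]
  | single g a =>
    rw [MonoidAlgebra.mapRingHom_single, Representation.asAlgebraHom_single,
      Representation.asAlgebraHom_single, twistEnd_smul, twistRep_apply]

theorem twistRep_isIrreducible (τ : F ≃ₐ[O] F) {d : ℕ} {ρ : Representation F G (Fin d → F)}
    (h : ρ.IsIrreducible) : (twistRep τ ρ).IsIrreducible := by
  rw [Representation.isIrreducible_iff_forall] at h ⊢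
  refine ⟨h.1, fun U hU => ?_⟩
  -- Stable subspaces correspond under the `τ`-semilinear bijection v ↦ τ ∘ v.
  let U' : Submodule F (Fin d → F) :=
    { carrier := {v | τ ∘ v ∈ U}
      zero_mem' := by
        change τ ∘ (0 : Fin d → F) ∈ U
        convert U.zero_mem
        funext i; exact map_zero τ
      add_mem' := fun {x y} hx hy => by
        change τ ∘ (x + y) ∈ U
        convert U.add_mem hx hy
        ext i; simp
      smul_mem' := fun c x hx => by
        change τ ∘ (c • x) ∈ U
        convert U.smul_mem (τ c) hx
        ext i; simp }
  have hmem : ∀ v, v ∈ U' ↔ τ ∘ v ∈ U := fun v => Iff.rfl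
  have hsymm : ∀ v : Fin d → F, τ ∘ (τ.symm ∘ v) = v := fun v => by ext i; simp
  refine (h.2 U' fun g v hv => ?_).imp (fun hb => ?_) fun ht => ?_
  · rw [hmem, ← twistEnd_apply_comp]
    exact hU g _ hv
  · rw [Submodule.eq_bot_iff] at hb ⊢
    intro v hv
    have := hb (τ.symm ∘ v) ((hmem _).2 (by rwa [hsymm]))
    rw [← hsymm v, this]
    ext i; simp
  · rw [Submodule.eq_top_iff'] at ht ⊢
    intro v
    rw [← hsymm v]
    exact ht _

/-- The Brauer character of a Galois twist. -/
theorem IsBrauerCharacterOf.isGaloisConj [CharZero L] [IsAlgClosed L] [IsAlgClosed F] [Finite G]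
    {π : integralClosure O L →ₐ[O] F} {n : ℕ} [NeZero n] (hn : Nat.card G ∣ n)
    {τ : F ≃ₐ[O] F} {k : ℕ} (hτ : ∀ η : F, η ^ pPrimePart p n = 1 → τ η = η ^ k)
    {σ : cyclotomicSubfield n L ≃ₐ[ℚ] cyclotomicSubfield n L}
    (hσ : ∀ δ : cyclotomicSubfield n L, δ ^ pPrimePart p n = 1 → σ δ = δ ^ k)
    {d : ℕ} {ρ : Representation F G (Fin d → F)} {φ ψ : PRegular p G → L}
    (hφ : IsBrauerCharacterOf p π ρ φ) (hψ : IsBrauerCharacterOf p π (twistRep τ ρ) ψ) :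
    IsGaloisConj σ φ ψ := by
  intro g
  have hord : orderOf g.1 ∣ pPrimePart p n := by
    have h1 : orderOf g.1 ∣ p ^ n.factorization p * pPrimePart p n := by
      rw [pPrimePart, Nat.mul_div_cancel' (Nat.ordProj_dvd n p)]
      exact (orderOf_dvd_natCard g.1).trans hn
    exact (Nat.Coprime.pow_right _ g.2.symm).dvd_of_dvd_mul_left h1
  obtain ⟨s, hs1, hs2, hs3⟩ := isBrauerCharacterOf_iff.1 hφ g
  have hz : ∀ z ∈ s, z ^ pPrimePart p n = 1 := by
    intro z hz
    obtain ⟨e, he⟩ := hord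
    rw [he, pow_mul, hs1 z hz, one_pow]
  have hψg : ψ g = (s.map fun z : integralClosure O L => (z : L) ^ k).sum := by
    obtain ⟨s', hs1', hs2', hs3'⟩ := isBrauerCharacterOf_iff.1 hψ g
    obtain ⟨ℓ, -, hℓ⟩ := exists_lift_roots (p := p) π g.2
    -- The eigenvalues of the twist are the k-th powers of the old ones, and unique lifting promotes
    -- this from reductions to the roots of unity themselves.
    have h1 : s'.map π = (s.map (· ^ k)).map π := by
      rw [hs2', twistRep_apply, roots_charpoly_twistEnd, ← hs2, Multiset.map_map, Multiset.map_map]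
      refine Multiset.map_congr rfl fun z hzs => ?_
      rw [Function.comp_apply, Function.comp_apply, map_pow]
      exact hτ _ (by rw [← map_pow, hz z hzs, map_one])
    have key : ∀ s : Multiset (integralClosure O L), (∀ z ∈ s, z ^ orderOf g.1 = 1) →
        (s.map π).map ℓ = s := by
      intro s hs
      rw [Multiset.map_map]
      conv_rhs => rw [← Multiset.map_id s]
      exact Multiset.map_congr rfl fun z hz => hℓ z (hs z hz)
    have h2 : s' = s.map (· ^ k) := by
      rw [← key s' hs1', h1, key]
      intro z hz
      obtain ⟨y, hy, rfl⟩ := Multiset.mem_map.1 hz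
      rw [← pow_mul, mul_comm, pow_mul, hs1 y hy, one_pow]
    rw [hs3', h2, Multiset.map_map]
    simp
  have hmem : ∀ z ∈ s, (z : L) ∈ cyclotomicSubfield n L := by
    intro z hzs
    refine IntermediateField.subset_adjoin _ _ ?_
    obtain ⟨e, he⟩ := (orderOf_dvd_natCard g.1).trans hn
    have : (z : L) ^ orderOf g.1 = 1 := by
      rw [← SubmonoidClass.coe_pow, hs1 z hzs]; rfl
    change (z : L) ^ n = 1
    rw [he, pow_mul, this, one_pow]
  refine ⟨(s.attach.map fun z => (⟨(z.1 : L), hmem z.1 z.2⟩ : cyclotomicSubfield n L)).sum, ?_, ?_⟩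
  · rw [hs3]
    refine (map_multiset_sum (cyclotomicSubfield n L).val _).trans ?_
    rw [Multiset.map_map]
    exact congrArg Multiset.sum (Multiset.attach_map_val' s (integralClosure O L).val)
  · rw [hψg, map_multiset_sum]
    refine (map_multiset_sum (cyclotomicSubfield n L).val _).trans ?_
    rw [Multiset.map_map, Multiset.map_map]
    rw [← Multiset.attach_map_val' s fun z : integralClosure O L => (z : L) ^ k]
    refine congrArg Multiset.sum (Multiset.map_congr rfl fun z _ => ?_)
    rw [Function.comp_apply, Function.comp_apply, hσ]
    · rfl
    · apply Subtype.ext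
      have h := congrArg (fun y : integralClosure O L => (y : L)) (hz z.1 z.2)
      exact h

end

/-! ### Trace functionals on a block -/

theorem map_add_pow_char {R F : Type*} [Ring R] [Ring F] (p : ℕ) [hp : Fact p.Prime] [CharP F p]
    (t : R →+ F) (ht : ∀ x y, t (x * y) = t (y * x)) (x y : R) :
    t ((x + y) ^ p) = t (x ^ p) + t (y ^ p) := by
  simpa using map_sum_pow_char p t ht Finset.univ (fun i : Bool => if i then x else y)

section
variable {F : Type*} [Field F] {p : ℕ} [Fact p.Prime] [CharP F p] {G : Type v} [Group G]

/-- The character of a representation, on the group algebra. -/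
def repTrace {d : ℕ} (ρ : Representation F G (Fin d → F)) : MonoidAlgebra F G →ₗ[F] F :=
  LinearMap.trace F (Fin d → F) ∘ₗ ρ.asAlgebraHom.toLinearMap

theorem repTrace_apply {d : ℕ} (ρ : Representation F G (Fin d → F)) (x : MonoidAlgebra F G) :
    repTrace ρ x = LinearMap.trace F _ (ρ.asAlgebraHom x) := rfl

theorem repTrace_single_one {d : ℕ} (ρ : Representation F G (Fin d → F)) (g : G) :
    repTrace ρ (MonoidAlgebra.single g 1) = LinearMap.trace F _ (ρ g) := by
  rw [repTrace_apply, Representation.asAlgebraHom_single_one]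

theorem isFrobeniusTrace_repTrace {d : ℕ} (ρ : Representation F G (Fin d → F)) :
    IsFrobeniusTrace p (repTrace ρ).toAddMonoidHom := by
  have h := (isFrobeniusTrace_of_matrix (F := F) (ι := Fin d) p).comp
    ((LinearMap.toMatrixAlgEquiv' (R := F) (n := Fin d)).toAlgHom.comp
      ρ.asAlgebraHom).toRingHom.toAddMonoidHom (fun x y => map_mul
      ((LinearMap.toMatrixAlgEquiv' (R := F) (n := Fin d)).toAlgHom.comp ρ.asAlgebraHom) x y) (Fact.out : p.Prime).ne_zero
  convert h using 1
  refine AddMonoidHom.ext fun x => ?_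
  change LinearMap.trace F _ (ρ.asAlgebraHom x) = (LinearMap.toMatrix' (ρ.asAlgebraHom x)).trace
  conv_lhs => rw [← Matrix.toLin'_toMatrix' (ρ.asAlgebraHom x), Matrix.trace_toLin'_eq]

theorem coprime_orderOf_pow [Finite G] (g : G) :
    p.Coprime (orderOf (g ^ p ^ (orderOf g).factorization p)) := by
  rw [orderOf_pow, Nat.gcd_eq_right (Nat.ordProj_dvd _ _)]
  exact Nat.coprime_ordCompl Fact.out (orderOf_pos g).ne'

omit [Group G] in
theorem linearMap_ext_single {V : Type*} [AddCommGroup V] [Module F V]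
    {s t : MonoidAlgebra F G →ₗ[F] V}
    (h : ∀ g, s (MonoidAlgebra.single g 1) = t (MonoidAlgebra.single g 1)) : s = t := by
  refine LinearMap.ext fun x => ?_
  induction x using MonoidAlgebra.induction_linear with
  | zero => simp
  | add x y hx hy => rw [map_add, map_add, hx, hy]
  | single g a =>
    rw [← mul_one a, ← smul_eq_mul, ← MonoidAlgebra.smul_single, map_smul, map_smul, h]

/-- The Brauer character determines the trace at p-regular elements. For any g some g^(p^a) is
p-regular, the trace there is the p^a-th power of the trace at g, and Frobenius is injective. -/
theorem repTrace_eq_of_isBrauerCharacterOf {O : Type u} [CommRing O] {L : Type w} [Field L]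
    [Algebra O L] [Algebra O F] [IsAlgClosed F] [Finite G] {π : integralClosure O L →ₐ[O] F}
    {d d' : ℕ} {ρ : Representation F G (Fin d → F)} {ρ' : Representation F G (Fin d' → F)}
    {φ : PRegular p G → L} (h : IsBrauerCharacterOf p π ρ φ) (h' : IsBrauerCharacterOf p π ρ' φ) :
    repTrace ρ = repTrace ρ' := by
  have hreg : ∀ g : PRegular p G, repTrace ρ (MonoidAlgebra.single g.1 1) =
      repTrace ρ' (MonoidAlgebra.single g.1 1) := by
    intro g
    obtain ⟨z, hz, hz'⟩ := h.exists_reduction_eq_trace g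
    obtain ⟨y, hy, hy'⟩ := h'.exists_reduction_eq_trace g
    rw [repTrace_single_one, repTrace_single_one, ← hz', ← hy']
    congr 1
    exact Subtype.ext (hz.trans hy.symm)
  refine linearMap_ext_single fun g => ?_
  have h1 := (isFrobeniusTrace_repTrace (p := p) ρ).map_pow_pow (MonoidAlgebra.single g 1)
    ((orderOf g).factorization p)
  have h2 := (isFrobeniusTrace_repTrace (p := p) ρ').map_pow_pow (MonoidAlgebra.single g 1)
    ((orderOf g).factorization p)
  rw [MonoidAlgebra.single_pow, one_pow] at h1 h2
  have h3 := hreg ⟨_, coprime_orderOf_pow (p := p) g⟩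
  refine iterateFrobenius_inj F p ((orderOf g).factorization p) ?_
  exact h1.symm.trans (h3.trans h2)

/-! ### Frobenius traces on the group algebra are prime-field combinations of irreducible characters
-/

namespace SemisimpleQuotient

variable (Q : SemisimpleQuotient F G)

theorem repTrace_rep (i : Fin Q.l) (x : MonoidAlgebra F G) :
    repTrace (Q.rep i) x = (Q.q x i).trace := by
  rw [repTrace_apply, rep_asAlgebraHom, Matrix.trace_toLin'_eq]

/-- An element of the group algebra which acts as a matrix unit on the `i`-th simple module
and as zero on the others. -/
def unitAt (i : Fin Q.l) : MonoidAlgebra F G :=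
  (Q.surjective (Pi.single i (Matrix.single 0 0 1))).choose

theorem q_unitAt (i : Fin Q.l) : Q.q (Q.unitAt i) = Pi.single i (Matrix.single 0 0 1) :=
  (Q.surjective (Pi.single i (Matrix.single 0 0 1))).choose_spec

theorem repTrace_unitAt (i j : Fin Q.l) : repTrace (Q.rep j) (Q.unitAt i) = if j = i then 1 else 0 := by
  rw [repTrace_rep, q_unitAt]
  split_ifs with h
  · subst h; simp
  · rw [Pi.single_eq_of_ne h, Matrix.trace_zero]

/-- `T` depends only on the image in a product of matrix algebras. A trace functional there vanishes
on off-diagonal units and is constant on the diagonal units of a block, hence is a combination of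
the matrix traces. -/
theorem exists_coeff {T : MonoidAlgebra F G →ₗ[F] F} (hT : IsFrobeniusTrace p T.toAddMonoidHom)
    (hker : ∀ x, Q.q x = 0 → T x = 0) :
    ∃ c : Fin Q.l → ZMod p, ∀ x,
      T x = ∑ i, ZMod.castHom dvd_rfl F (c i) * repTrace (Q.rep i) x := by
  have hcongr : ∀ x y, Q.q x = Q.q y → T x = T y := fun x y h => by
    rw [← sub_eq_zero, ← map_sub]; exact hker _ (by rw [map_sub, h, sub_self])
  have hcomm : ∀ x y, T (x * y) = T (y * x) := hT.map_mul_comm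
  choose E hE using fun (i : Fin Q.l) (a b : Fin (Q.d i)) =>
    Q.surjective (Pi.single i (Matrix.single a b 1))
  -- The image of this element is idempotent, so the Frobenius property gives c^p = c; this forces
  -- the coefficient into the prime field.
  have hE0 : ∀ i, T (E i 0 0) ^ p = T (E i 0 0) := by
    intro i
    refine (hT.map_pow (E i 0 0)).symm.trans (hcongr _ _ ?_)
    have hidem : IsIdempotentElem (Q.q (E i 0 0)) := by
      rw [IsIdempotentElem, hE, ← Pi.single_mul, Matrix.single_mul_single_same, one_mul]
    rw [map_pow, hidem.pow_eq (Fact.out : p.Prime).ne_zero]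
  have hdiag : ∀ i a, T (E i a a) = T (E i 0 0) := by
    intro i a
    rw [hcongr (E i a a) (E i a 0 * E i 0 a), hcomm, hcongr (E i 0 a * E i a 0) (E i 0 0)]
    · rw [map_mul, hE, hE, hE, ← Pi.single_mul, Matrix.single_mul_single_same, one_mul]
    · rw [map_mul, hE, hE, hE, ← Pi.single_mul, Matrix.single_mul_single_same, one_mul]
  have hoff : ∀ i a b, a ≠ b → T (E i a b) = 0 := by
    intro i a b hab
    rw [hcongr (E i a b) (E i a b * E i b b), hcomm]
    · refine hker _ ?_
      rw [map_mul, hE, hE, ← Pi.single_mul, Matrix.single_mul_single_of_ne _ _ _ _ hab.symm,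
        Pi.single_zero]
    · rw [map_mul, hE, hE, ← Pi.single_mul, Matrix.single_mul_single_same, one_mul]
  have hc : ∀ i, ∃ c : ZMod p, ZMod.castHom dvd_rfl F c = T (E i 0 0) := by
    intro i
    have := (Subfield.mem_bot_iff_pow_eq_self F p).2 (hE0 i)
    rw [← ZMod.fieldRange_castHom_eq_bot p] at this
    exact this
  choose c hc using hc
  refine ⟨c, fun x => ?_⟩
  have hx : Q.q x = Q.q (∑ i, ∑ a, ∑ b, Q.q x i a b • E i a b) := by
    simp only [map_sum, map_smul, hE]
    have h1 : ∀ i, ∑ a, ∑ b, Q.q x i a b • (Pi.single i (Matrix.single a b 1) :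
        Π i, Matrix (Fin (Q.d i)) (Fin (Q.d i)) F) = Pi.single i (Q.q x i) := by
      intro i
      conv_rhs => rw [Matrix.matrix_eq_sum_single (Q.q x i)]
      change _ = LinearMap.single F (fun i => Matrix (Fin (Q.d i)) (Fin (Q.d i)) F) i _
      rw [map_sum]
      refine Finset.sum_congr rfl fun a _ => ?_
      rw [map_sum]
      refine Finset.sum_congr rfl fun b _ => ?_
      rw [LinearMap.single_apply, ← Pi.single_smul, Matrix.smul_single, smul_eq_mul, mul_one]
    rw [Finset.sum_congr rfl fun i _ => h1 i, Finset.univ_sum_single]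
  rw [hcongr _ _ hx]
  simp only [map_sum, map_smul, smul_eq_mul, hc, repTrace_rep, Matrix.trace, Matrix.diag_apply]
  refine Finset.sum_congr rfl fun i _ => ?_
  rw [Finset.mul_sum]
  refine Finset.sum_congr rfl fun a _ => ?_
  rw [Finset.sum_eq_single a, hdiag, mul_comm]
  · intro b _ hba
    rw [hoff i a b hba.symm, mul_zero]
  · simp

end SemisimpleQuotient

end

/-! ### Passage between the corner ring over `O` and the group algebra over `F` -/

section
variable {O : Type u} [CommRing O] {F : Type*} [Field F] [Algebra O F] {p : ℕ} [Fact p.Prime]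
  [CharP F p] {G : Type v} [Group G] {b : MonoidAlgebra O G}

variable (F) in
/-- The reduction of coefficients to `F`. -/
abbrev reduceCoeff : MonoidAlgebra O G →+* MonoidAlgebra F G :=
  MonoidAlgebra.mapRingHom G (algebraMap O F)

theorem reduceCoeff_smul (a : O) (x : MonoidAlgebra O G) :
    reduceCoeff F (a • x) = algebraMap O F a • reduceCoeff F x := by
  induction x using MonoidAlgebra.induction_linear with
  | zero => simp
  | add x y hx hy => rw [smul_add, map_add, map_add, smul_add, hx, hy]
  | single g c => simp [MonoidAlgebra.mapRingHom_single, Algebra.smul_def]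

theorem commute_reduceCoeff (hc : b ∈ Subring.center (MonoidAlgebra O G)) (x : MonoidAlgebra F G) :
    x * reduceCoeff F b = reduceCoeff F b * x := by
  induction x using MonoidAlgebra.induction_linear with
  | zero => simp
  | add x y hx hy => rw [add_mul, mul_add, hx, hy]
  | single g a =>
    have h1 : (MonoidAlgebra.single g a : MonoidAlgebra F G) =
        a • reduceCoeff F (MonoidAlgebra.single g (1 : O)) := by
      simp [MonoidAlgebra.mapRingHom_single]
    rw [h1, smul_mul_assoc, mul_smul_comm, ← map_mul, ← map_mul, Subring.mem_center_iff.1 hc]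

/-- As `b` is central, the image of its action is a subrepresentation, so it is zero or everything;
an idempotent with full image is 1. -/
theorem asAlgebraHom_reduceCoeff_eq_zero_or_one (he : IsIdempotentElem b)
    (hc : b ∈ Subring.center (MonoidAlgebra O G)) {V : Type*} [AddCommGroup V] [Module F V]
    {ρ : Representation F G V} (h : ρ.IsIrreducible) :
    ρ.asAlgebraHom (reduceCoeff F b) = 0 ∨ ρ.asAlgebraHom (reduceCoeff F b) = 1 := by
  set f := ρ.asAlgebraHom (reduceCoeff F b) with hf
  have hff : f * f = f := by rw [hf, ← map_mul, ← map_mul, he.eq]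
  refine ((ρ.isIrreducible_iff_forall.1 h).2 (LinearMap.range f) ?_).imp
    LinearMap.range_eq_bot.1 fun ht => ?_
  · rintro g _ ⟨v, rfl⟩
    refine ⟨ρ g v, ?_⟩
    rw [← ρ.asAlgebraHom_single_one, ← Module.End.mul_apply, ← Module.End.mul_apply, hf, ← map_mul,
      ← map_mul, commute_reduceCoeff hc]
  · ext v
    obtain ⟨v, rfl⟩ := LinearMap.range_eq_top.1 ht v
    exact LinearMap.congr_fun hff v

/-- The projection to the corner ring. -/
def toCorner (he : IsIdempotentElem b) : MonoidAlgebra O G →ₗ[O] he.Corner where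
  toFun x := ⟨b * x * b, x, rfl⟩
  map_add' x y := Subtype.ext ((congrArg (· * b) (mul_add b x y)).trans (add_mul _ _ _))
  map_smul' a x := Subtype.ext ((congrArg (· * b) (mul_smul_comm a b x)).trans (smul_mul_assoc _ _ _))

theorem toCorner_val (he : IsIdempotentElem b) (x : he.Corner) : toCorner he x.1 = x := by
  obtain ⟨h1, h2⟩ := (Subsemigroup.mem_corner_iff he).1 x.2
  exact Subtype.ext (by change b * x.1 * b = x.1; rw [h1, h2])

theorem toCorner_mul (he : IsIdempotentElem b) (hc : b ∈ Subring.center (MonoidAlgebra O G))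
    (x y : MonoidAlgebra O G) : toCorner he (x * y) = toCorner he x * toCorner he y := by
  have hb := Subring.mem_center_iff.1 hc
  refine Subtype.ext ?_
  change b * (x * y) * b = (b * x * b) * (b * y * b)
  rw [← hb x, mul_assoc x b b, he.eq, ← hb (x * y), ← hb y, mul_assoc (x * y), he.eq,
    mul_assoc y b b, he.eq, mul_assoc x b (y * b), ← mul_assoc b y b, ← hb y, mul_assoc y b b,
    he.eq, mul_assoc]

theorem toCorner_mul_self (he : IsIdempotentElem b) (x : MonoidAlgebra O G) :
    toCorner he (x * b) = toCorner he x := by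
  refine Subtype.ext ?_
  change b * (x * b) * b = b * x * b
  rw [← mul_assoc, mul_assoc _ b b, he.eq]

/-- The extension to `F G` of a functional on the corner ring `b O G`. -/
def extendTrace (he : IsIdempotentElem b) (s : he.Corner →ₗ[O] F) : MonoidAlgebra F G →ₗ[F] F where
  toFun := MonoidAlgebra.liftNC (AddMonoidHom.id F)
    fun g => s (toCorner he (MonoidAlgebra.single g 1))
  map_add' := map_add _
  map_smul' a x := by
    induction x using MonoidAlgebra.induction_linear with
    | zero => simp
    | add x y hx hy => rw [smul_add, map_add, map_add, smul_add, hx, hy]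
    | single g c => simp [MonoidAlgebra.liftNC_single, mul_assoc]

theorem extendTrace_single (he : IsIdempotentElem b) (s : he.Corner →ₗ[O] F) (g : G) (a : F) :
    extendTrace he s (MonoidAlgebra.single g a) =
      a * s (toCorner he (MonoidAlgebra.single g 1)) :=
  MonoidAlgebra.liftNC_single _ _ _ _

theorem extendTrace_reduceCoeff (he : IsIdempotentElem b) (s : he.Corner →ₗ[O] F)
    (x : MonoidAlgebra O G) : extendTrace he s (reduceCoeff F x) = s (toCorner he x) := by
  induction x using MonoidAlgebra.induction_linear with
  | zero => simp
  | add x y hx hy => simp only [map_add, hx, hy]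
  | single g a =>
    rw [MonoidAlgebra.mapRingHom_single, extendTrace_single, ← Algebra.smul_def, ← map_smul,
      ← map_smul, MonoidAlgebra.smul_single, smul_eq_mul, mul_one]

/-- The extension ignores the complement of the block, which later kills the coefficients of simple
modules outside it. -/
theorem extendTrace_mul_reduceCoeff (he : IsIdempotentElem b) (s : he.Corner →ₗ[O] F)
    (x : MonoidAlgebra F G) : extendTrace he s (x * reduceCoeff F b) = extendTrace he s x := by
  induction x using MonoidAlgebra.induction_linear with
  | zero => simp
  | add x y hx hy => rw [add_mul, map_add, map_add, hx, hy]
  | single g a =>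
    have h1 : (MonoidAlgebra.single g a : MonoidAlgebra F G) =
        a • reduceCoeff F (MonoidAlgebra.single g (1 : O)) := by
      simp [MonoidAlgebra.mapRingHom_single]
    rw [h1, smul_mul_assoc, ← map_mul, map_smul, map_smul, extendTrace_reduceCoeff,
      extendTrace_reduceCoeff, toCorner_mul_self]

/-- Both sides of the p-th power condition are additive in x once the trace property is known, so it
suffices to test multiples of group elements. -/
theorem isFrobeniusTrace_extendTrace (he : IsIdempotentElem b)
    (hc : b ∈ Subring.center (MonoidAlgebra O G)) {s : he.Corner →ₗ[O] F}
    (hs : s ∈ frobeniusTraces O he.Corner F p) :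
    IsFrobeniusTrace p (extendTrace he s).toAddMonoidHom := by
  have hcomm : ∀ x y, extendTrace he s (x * y) = extendTrace he s (y * x) := by
    intro x y
    induction x using MonoidAlgebra.induction_linear with
    | zero => simp
    | add x x' hx hx' => rw [add_mul, mul_add, map_add, map_add, hx, hx']
    | single g a =>
      induction y using MonoidAlgebra.induction_linear with
      | zero => simp
      | add y y' hy hy' => rw [add_mul, mul_add, map_add, map_add, hy, hy']
      | single h a' =>
        have hgh : ∀ g h : G, (MonoidAlgebra.single (g * h) 1 : MonoidAlgebra O G) =
            MonoidAlgebra.single g 1 * MonoidAlgebra.single h 1 := fun g h => by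
          rw [MonoidAlgebra.single_mul_single, mul_one]
        rw [MonoidAlgebra.single_mul_single, MonoidAlgebra.single_mul_single, extendTrace_single,
          extendTrace_single, hgh, hgh, toCorner_mul he hc, toCorner_mul he hc, mul_comm a]
        exact congrArg _ (hs.map_mul_comm _ _)
  refine ⟨hcomm, fun x => ?_⟩
  change extendTrace he s (x ^ p) = extendTrace he s x ^ p
  induction x using MonoidAlgebra.induction_linear with
  | zero => simp [(Fact.out : p.Prime).ne_zero]
  | add x y hx hy =>
    have := map_add_pow_char p (extendTrace he s).toAddMonoidHom hcomm x y
    refine this.trans ?_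
    rw [map_add, add_pow_char]
    exact congrArg₂ (· + ·) hx hy
  | single g a =>
    rw [MonoidAlgebra.single_pow, extendTrace_single, extendTrace_single, mul_pow]
    congr 1
    refine Eq.trans ?_ (hs.map_pow _)
    have hpow : ∀ (k : ℕ) (x : MonoidAlgebra O G),
        toCorner he (x ^ (k + 1)) = toCorner he x ^ (k + 1) := by
      intro k x
      induction k with
      | zero => simp
      | succ k ih => rw [pow_succ, toCorner_mul he hc, ih, ← pow_succ]
    obtain ⟨k, hk⟩ := Nat.exists_eq_succ_of_ne_zero (Fact.out : p.Prime).ne_zero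
    rw [hk, ← hpow, MonoidAlgebra.single_pow, one_pow]
    rfl

variable (p) in
/-- The trace functional of a representation, on the corner ring `b O G`. -/
def cornerTrace (he : IsIdempotentElem b) {d : ℕ} (ρ : Representation F G (Fin d → F)) :
    frobeniusTraces O he.Corner F p :=
  ⟨{ toFun := fun x => repTrace ρ (reduceCoeff F x.1)
     map_add' := fun x y => 
      (congrArg (repTrace ρ) (map_add (reduceCoeff F) x.1 y.1)).trans (map_add _ _ _)
     map_smul' := fun a x => 
      (congrArg (repTrace ρ) (reduceCoeff_smul a x.1)).trans
        ((map_smul _ _ _).trans (Algebra.smul_def _ _).symm) },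
    (isFrobeniusTrace_repTrace ρ).comp
      { toFun := fun x : he.Corner => reduceCoeff F x.1
        map_zero' := map_zero (reduceCoeff F)
        map_add' := fun x y => map_add (reduceCoeff F) x.1 y.1 }
      (fun x y => map_mul (reduceCoeff F) x.1 y.1) (Fact.out : p.Prime).ne_zero⟩

theorem cornerTrace_apply (he : IsIdempotentElem b) {d : ℕ} (ρ : Representation F G (Fin d → F))
    (x : he.Corner) : (cornerTrace p he ρ).1 x = repTrace ρ (reduceCoeff F x.1) := rfl

theorem cornerTrace_twistRep (he : IsIdempotentElem b) {d : ℕ}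
    (ρ : Representation F G (Fin d → F)) (τ : F ≃ₐ[O] F) :
    cornerTrace p he (twistRep τ ρ) = twistTrace τ (cornerTrace p he ρ) := by
  apply Subtype.ext
  ext x
  rw [cornerTrace_apply, repTrace_apply, twistRep_asAlgebraHom, trace_twistEnd]
  rfl

end

/-! ### The Galois action on the Brauer characters of a block -/

section
variable {O : Type u} [CommRing O] {L : Type w} [Field L] [Algebra O L]
  {F : Type w'} [Field F] [Algebra O F] {p : ℕ} {G : Type v} [Group G]
  {π : integralClosure O L →ₐ[O] F} {b : MonoidAlgebra O G}

namespace IBr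

/-- The dimension of a simple module with a given Brauer character. -/
def dim (φ : IBr p π b) : ℕ := φ.2.choose

/-- A simple module with a given Brauer character. -/
def rep (φ : IBr p π b) : Representation F G (Fin (dim φ) → F) := φ.2.choose_spec.choose

theorem rep_isIrreducible (φ : IBr p π b) : (rep φ).IsIrreducible := φ.2.choose_spec.choose_spec.1

theorem rep_reduceCoeff (φ : IBr p π b) : (rep φ).asAlgebraHom (reduceCoeff F b) = 1 :=
  φ.2.choose_spec.choose_spec.2.1

theorem isBrauerCharacterOf_rep (φ : IBr p π b) : IsBrauerCharacterOf p π (rep φ) φ.1 :=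
  φ.2.choose_spec.choose_spec.2.2

variable [Fact p.Prime] [CharP F p] [CharZero L] [IsAlgClosed L] [IsAlgClosed F]

section
variable (Q : SemisimpleQuotient F G)

omit [Fact p.Prime] [CharP F p] [CharZero L] [IsAlgClosed L] [IsAlgClosed F] in
theorem exists_index (φ : IBr p π b) :
    ∃ i, IsBrauerCharacterOf p π (Q.rep i) φ.1 ∧ repTrace (rep φ) = repTrace (Q.rep i) := by
  obtain ⟨i, e, he⟩ := Q.exists_equiv_rep (rep_isIrreducible φ)
  refine ⟨i, (isBrauerCharacterOf_rep φ).congr fun g => ?_, ?_⟩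
  · have h := he (MonoidAlgebra.single g 1)
    rw [Representation.asAlgebraHom_single_one, Representation.asAlgebraHom_single_one] at h
    rw [h, LinearEquiv.charpoly_conj]
  · ext x
    simp only [LinearMap.comp_apply, repTrace_apply, he]
    exact LinearMap.trace_conj' _ e

/-- The position of a simple module in the semisimple quotient. -/
def index (φ : IBr p π b) : Fin Q.l := (exists_index Q φ).choose

omit [IsAlgClosed F] in
theorem index_injective : Function.Injective (index Q : IBr p π b → Fin Q.l) := by
  intro φ ψ h
  have h1 := (exists_index Q φ).choose_spec.1
  have h2 := (exists_index Q ψ).choose_spec.1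
  change IsBrauerCharacterOf p π (Q.rep (index Q φ)) _ at h1
  change IsBrauerCharacterOf p π (Q.rep (index Q ψ)) _ at h2
  rw [h] at h1
  exact Subtype.ext (h1.eq h2 fun _ => rfl)

omit [Fact p.Prime] [CharP F p] [CharZero L] [IsAlgClosed L] [IsAlgClosed F] in
theorem repTrace_rep (φ : IBr p π b) : repTrace (rep φ) = repTrace (Q.rep (index Q φ)) :=
  (exists_index Q φ).choose_spec.2

/-- The module chosen for the Brauer character of the i-th simple module has the same trace as that
module, and the elements `Q.unitAt` separate the traces of different simple modules. -/
theorem exists_index_eq [Finite G] (i : Fin Q.l)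
    (hi : (Q.rep i).asAlgebraHom (reduceCoeff F b) = 1) : ∃ φ : IBr p π b, index Q φ = i := by
  obtain ⟨φ, hφ⟩ := exists_isBrauerCharacterOf (p := p) π (Q.rep i)
  let φ' : IBr p π b := ⟨φ, Q.d i, Q.rep i, Q.rep_isIrreducible i, hi, hφ⟩
  refine ⟨φ', ?_⟩
  have h1 : repTrace (Q.rep (index Q φ')) = repTrace (Q.rep i) :=
    (repTrace_rep Q φ').symm.trans
      (repTrace_eq_of_isBrauerCharacterOf (isBrauerCharacterOf_rep φ') hφ)
  by_contra hne
  have h2 := LinearMap.congr_fun h1 (Q.unitAt i)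
  rw [Q.repTrace_unitAt, Q.repTrace_unitAt, if_neg hne, if_pos rfl] at h2
  exact zero_ne_one h2

end

instance [Finite G] : Finite (IBr p π b) :=
  have ⟨Q⟩ := SemisimpleQuotient.nonempty (F := F) (G := G)
  Finite.of_injective _ (index_injective Q)

theorem exists_dual [Finite G] [DecidableEq (IBr p π b)] (φ : IBr p π b) : ∃ x : MonoidAlgebra F G,
    ∀ ψ : IBr p π b, repTrace (rep ψ) x = if ψ = φ then 1 else 0 := by
  obtain ⟨Q⟩ := SemisimpleQuotient.nonempty (F := F) (G := G)
  refine ⟨Q.unitAt (index Q φ), fun ψ => ?_⟩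
  rw [repTrace_rep Q, Q.repTrace_unitAt]
  exact if_congr (index_injective Q).eq_iff rfl rfl

variable [Fintype (IBr p π b)]

/-- The combination of the characters of the simple modules of a block with coefficients in the
prime field. -/
def combination (he : IsIdempotentElem b) (c : IBr p π b → ZMod p) :
    frobeniusTraces O he.Corner F p :=
  ∑ φ, (c φ).val • cornerTrace p he (rep φ)

omit [CharZero L] [IsAlgClosed L] [IsAlgClosed F] in
theorem combination_apply (he : IsIdempotentElem b) (c : IBr p π b → ZMod p) (x : he.Corner) :
    (combination he c).1 x =
      ∑ φ, ZMod.castHom dvd_rfl F (c φ) * repTrace (rep φ) (reduceCoeff F x.1) := by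
  simp only [combination, AddSubgroup.val_finsetSum, LinearMap.sum_apply]
  refine Finset.sum_congr rfl fun φ _ => ?_
  rw [ZMod.castHom_apply, ← ZMod.natCast_val, ← nsmul_eq_mul]
  rfl

omit [CharZero L] [IsAlgClosed L] [IsAlgClosed F] in
theorem extendTrace_combination (he : IsIdempotentElem b) (c : IBr p π b → ZMod p)
    (x : MonoidAlgebra F G) :
    extendTrace he (combination he c).1 x =
      ∑ φ, ZMod.castHom dvd_rfl F (c φ) * repTrace (rep φ) x := by
  have h : extendTrace he (combination he c).1 =
      ∑ φ, ZMod.castHom dvd_rfl F (c φ) • repTrace (rep φ) := by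
    refine linearMap_ext_single fun g => ?_
    rw [extendTrace_single, one_mul, combination_apply, LinearMap.sum_apply]
    refine Finset.sum_congr rfl fun φ _ => ?_
    change _ * repTrace (rep φ) (reduceCoeff F (b * MonoidAlgebra.single g 1 * b)) = _
    have hg : (rep φ).asAlgebraHom (reduceCoeff F (b * MonoidAlgebra.single g 1 * b)) =
        (rep φ).asAlgebraHom (MonoidAlgebra.single g 1) := by
      rw [map_mul, map_mul, map_mul, map_mul, rep_reduceCoeff, one_mul, mul_one,
        MonoidAlgebra.mapRingHom_single, map_one]
    rw [LinearMap.smul_apply, smul_eq_mul, repTrace_apply, hg, repTrace_apply]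
  rw [h]
  simp

theorem combination_injective [Finite G] (he : IsIdempotentElem b) :
    Function.Injective (combination (p := p) (π := π) he) := by
  intro c c' h
  funext φ
  classical
  obtain ⟨x, hx⟩ := exists_dual φ
  have h1 := extendTrace_combination he c x
  rw [h, extendTrace_combination] at h1
  simp only [hx, mul_ite, mul_one, mul_zero, Finset.sum_ite_eq', Finset.mem_univ, if_true] at h1
  exact (ZMod.castHom dvd_rfl F).injective h1.symm

/-- Extend the functional to the group algebra, where it kills the nilpotent Jacobson radical and so
is a prime-field combination of all irreducible characters; then only the simple modules of the
block can occur. -/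
theorem combination_surjective [Finite G] (he : IsIdempotentElem b)
    (hc : b ∈ Subring.center (MonoidAlgebra O G)) :
    Function.Surjective (combination (p := p) (π := π) he) := by
  intro s
  obtain ⟨Q⟩ := SemisimpleQuotient.nonempty (F := F) (G := G)
  have hT := isFrobeniusTrace_extendTrace he hc s.2
  have : IsArtinianRing (MonoidAlgebra F G) := IsArtinianRing.of_finite F _
  obtain ⟨c, hcT⟩ := Q.exists_coeff hT fun x hx =>
    hT.map_eq_zero_of_isNilpotent (isNilpotent_of_mem_jacobson (Q.mem_jacobson x hx))
  have hzero : ∀ i, (∀ φ : IBr p π b, index Q φ ≠ i) → ZMod.castHom dvd_rfl F (c i) = 0 := by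
    intro i hi
    have h0 : (Q.rep i).asAlgebraHom (reduceCoeff F b) = 0 :=
      (asAlgebraHom_reduceCoeff_eq_zero_or_one he hc (Q.rep_isIrreducible i)).resolve_right
        fun h1 => by
          obtain ⟨φ, hφ⟩ := exists_index_eq (p := p) (π := π) Q i h1
          exact hi φ hφ
    -- If `b` acts as zero on the i-th simple module, multiplying `Q.unitAt i` by `b` kills every
    -- trace, whereas without `b` the value is the i-th coefficient.
    have h1 := extendTrace_mul_reduceCoeff he s.1 (Q.unitAt i)
    rw [hcT, hcT, Finset.sum_eq_zero] at h1
    · simp only [Q.repTrace_unitAt, mul_ite, mul_one, mul_zero, Finset.sum_ite_eq',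
        Finset.mem_univ, if_true] at h1
      exact h1.symm
    · intro j _
      obtain rfl | hji := eq_or_ne j i
      · rw [repTrace_apply, map_mul, h0, mul_zero, map_zero, mul_zero]
      · rw [Q.repTrace_rep, map_mul, Q.q_unitAt, Pi.mul_apply, Pi.single_eq_of_ne hji, zero_mul,
          Matrix.trace_zero, mul_zero]
  refine ⟨fun φ => c (index Q φ), Subtype.ext (LinearMap.ext fun x => ?_)⟩
  have hx := extendTrace_reduceCoeff he s.1 x.1
  rw [toCorner_val, hcT] at hx
  rw [combination_apply, ← hx]
  refine Finset.sum_of_injOn (index Q) (index_injective Q).injOn (by simp) ?_ ?_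
  · intro i _ hi
    rw [hzero i fun φ hφ => hi ⟨φ, by simp, hφ⟩, zero_mul]
  · intro φ _
    rw [repTrace_rep Q]

omit [Fintype (IBr p π b)]

variable [Finite G]

omit [IsAlgClosed F] [Finite G] in
theorem exists_twist (τ : F ≃ₐ[O] F) (φ : IBr p π b) :
    ∃ ψ : IBr p π b, IsBrauerCharacterOf p π (twistRep τ (rep φ)) ψ.1 := by
  obtain ⟨ψ, hψ⟩ := exists_isBrauerCharacterOf (p := p) π (twistRep τ (rep φ))
  exact ⟨⟨ψ, dim φ, twistRep τ (rep φ), twistRep_isIrreducible τ (rep_isIrreducible φ), by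
    rw [twistRep_asAlgebraHom, rep_reduceCoeff, map_one], hψ⟩, hψ⟩

/-- The Galois twist of a Brauer character. -/
def twist (τ : F ≃ₐ[O] F) (φ : IBr p π b) : IBr p π b := (exists_twist τ φ).choose

omit [IsAlgClosed F] [Finite G] in
theorem isBrauerCharacterOf_twist (τ : F ≃ₐ[O] F) (φ : IBr p π b) :
    IsBrauerCharacterOf p π (twistRep τ (rep φ)) (twist τ φ).1 := (exists_twist τ φ).choose_spec

/-- The module chosen for the twisted character is not literally the twisted module, but both afford
the same Brauer character and hence the same trace. -/
theorem cornerTrace_twist (he : IsIdempotentElem b) (τ : F ≃ₐ[O] F) (φ : IBr p π b) :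
    cornerTrace p he (rep (twist τ φ)) = twistTrace τ (cornerTrace p he (rep φ)) := by
  rw [← cornerTrace_twistRep]
  have h := repTrace_eq_of_isBrauerCharacterOf (isBrauerCharacterOf_rep (twist τ φ))
    (isBrauerCharacterOf_twist τ φ)
  apply Subtype.ext
  ext x
  rw [cornerTrace_apply, cornerTrace_apply, h]

theorem cornerTrace_injective (he : IsIdempotentElem b) :
    Function.Injective fun φ : IBr p π b => cornerTrace p he (rep φ) := by
  classical
  have := Fintype.ofFinite (IBr p π b)
  intro φ ψ h
  have : Fact (1 < p) := ⟨(Fact.out : p.Prime).one_lt⟩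
  have key : ∀ φ : IBr p π b, combination he (Pi.single φ 1) = cornerTrace p he (rep φ) := by
    intro φ
    rw [combination, Finset.sum_eq_single φ]
    · rw [Pi.single_eq_same, ZMod.val_one, one_nsmul]
    · intro ψ _ hψ
      rw [Pi.single_eq_of_ne hψ, ZMod.val_zero, zero_nsmul]
    · simp
  have h1 := combination_injective he ((key φ).trans (h.trans (key ψ).symm))
  by_contra hne
  have h2 := congrFun h1 φ
  rw [Pi.single_eq_same, Pi.single_eq_of_ne hne] at h2
  exact one_ne_zero h2

/-- The action of field automorphisms on the Brauer characters of a block. -/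
def twistHom (he : IsIdempotentElem b) : (F ≃ₐ[O] F) →* Equiv.Perm (IBr p π b) :=
  letI : MulAction (F ≃ₐ[O] F) (IBr p π b) :=
    { smul := twist
      -- Corner traces separate the Brauer characters, so the action laws follow from those for
      -- composing functionals with `τ`.
      one_smul := fun φ => cornerTrace_injective he (cornerTrace_twist he 1 φ)
      mul_smul := fun τ τ' φ => cornerTrace_injective he ((cornerTrace_twist he (τ * τ') φ).trans (by
        change _ = cornerTrace p he (rep (twist τ (twist τ' φ)))
        rw [cornerTrace_twist he τ, cornerTrace_twist he τ']
        rfl)) }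
  MulAction.toPermHom _ _

theorem twistHom_apply (he : IsIdempotentElem b) (τ : F ≃ₐ[O] F) (φ : IBr p π b) :
    twistHom he τ φ = twist τ φ := rfl

/-- Coefficients in the prime field are fixed by `τ`, so twisting only permutes the characters; on
coefficient functions this is composition with the inverse permutation. -/
theorem combination_comp_twistHom [Fintype (IBr p π b)] (he : IsIdempotentElem b) (τ : F ≃ₐ[O] F)
    (c : IBr p π b → ZMod p) :
    combination he (c ∘ ((twistHom he τ)⁻¹ : Equiv.Perm (IBr p π b))) = twistTrace τ (combination he c) := by
  apply Subtype.ext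
  ext x
  change (combination he (c ∘ ((twistHom he τ)⁻¹ : Equiv.Perm (IBr p π b)))).1 x = τ ((combination he c).1 x)
  rw [combination_apply, combination_apply, map_sum, ← Equiv.sum_comp (twistHom he τ)]
  refine Finset.sum_congr rfl fun φ _ => ?_
  rw [Function.comp_apply, show (twistHom he τ)⁻¹ (twistHom he τ φ) = φ from
    (twistHom he τ).symm_apply_apply φ, map_mul, twistHom_apply, ← cornerTrace_apply he (p := p),
    cornerTrace_twist]
  congr 1
  rw [ZMod.castHom_apply, ← ZMod.natCast_val, map_natCast]

theorem isGaloisConj_twist {n : ℕ} [NeZero n] (hn : Nat.card G ∣ n)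
    {τ : F ≃ₐ[O] F} {k : ℕ} (hτ : ∀ η : F, η ^ pPrimePart p n = 1 → τ η = η ^ k)
    {σ : cyclotomicSubfield n L ≃ₐ[ℚ] cyclotomicSubfield n L}
    (hσ : ∀ δ : cyclotomicSubfield n L, δ ^ pPrimePart p n = 1 → σ δ = δ ^ k) (φ : IBr p π b) :
    IsGaloisConj σ φ.1 (twist τ φ).1 :=
  (isBrauerCharacterOf_rep φ).isGaloisConj hn hτ hσ (isBrauerCharacterOf_twist τ φ)

end IBr

/-- Both groups of functionals are permutation modules over F_p on the Brauer characters, and `e`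
respects the action of `τ`, so the two permutations induced by `τ` have the same cycle type. -/
theorem exists_equiv_IBr [Fact p.Prime] [CharP F p] [CharZero L] [IsAlgClosed L] [IsAlgClosed F]
    [Finite G] {H : Type v₂} [Group H] [Finite H] {c : MonoidAlgebra O H}
    (hb : IsBlockIdempotent b) (hc : IsBlockIdempotent c)
    (e : frobeniusTraces O hb.idem.Corner F p ≃ frobeniusTraces O hc.idem.Corner F p)
    (he : ∀ (τ : F →ₐ[O] F) t, e (twistTrace τ t) = twistTrace τ (e t)) (τ : F ≃ₐ[O] F) :
    ∃ I : IBr p π b ≃ IBr p π c,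
      ∀ φ, I (IBr.twistHom hb.idem τ φ) = IBr.twistHom hc.idem τ (I φ) := by
  have := Fintype.ofFinite (IBr p π b)
  have := Fintype.ofFinite (IBr p π c)
  let eb := Equiv.ofBijective _ ⟨IBr.combination_injective (p := p) (π := π) hb.idem,
    IBr.combination_surjective hb.idem hb.central⟩
  let ec := Equiv.ofBijective _ ⟨IBr.combination_injective (p := p) (π := π) hc.idem,
    IBr.combination_surjective hc.idem hc.central⟩
  have : Fact (1 < p) := ⟨(Fact.out : p.Prime).one_lt⟩
  obtain ⟨I, hI⟩ := exists_equiv_of_permutationModule (IBr.twistHom hb.idem τ)⁻¹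
    (IBr.twistHom hc.idem τ)⁻¹ (eb.trans (e.trans ec.symm)) fun f => by
      change ec.symm (e (eb (f ∘ _))) = ec.symm (e (eb f)) ∘ _
      rw [Equiv.symm_apply_eq]
      refine Eq.trans ?_ (IBr.combination_comp_twistHom hc.idem τ _).symm
      change _ = twistTrace _ (ec (ec.symm _))
      rw [Equiv.apply_symm_apply, ← he]
      exact congrArg e (IBr.combination_comp_twistHom hb.idem τ f)
  refine ⟨I, fun φ => ?_⟩
  have h := hI (IBr.twistHom hb.idem τ φ)
  rw [show (IBr.twistHom hb.idem τ)⁻¹ (IBr.twistHom hb.idem τ φ) = φ from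
    (IBr.twistHom hb.idem τ).symm_apply_apply φ] at h
  rw [h]
  exact ((IBr.twistHom hc.idem τ).apply_symm_apply _).symm

end

/-! ### Automorphisms acting on roots of unity by powers of `p` -/

section
variable {F : Type*} [Field F] {O : Type*} [CommRing O] [Algebra O F]

/-- `τ` raises the `m`-th roots of unity to the `k`-th power. -/
def ActsAsPow (m k : ℕ) (τ : F ≃ₐ[O] F) : Prop := ∀ η : F, η ^ m = 1 → τ η = η ^ k

theorem ActsAsPow.mul {m k l : ℕ} {τ τ' : F ≃ₐ[O] F} (h : ActsAsPow m k τ)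
    (h' : ActsAsPow m l τ') : ActsAsPow m (k * l) (τ * τ') := fun η hη => by
  rw [AlgEquiv.mul_apply, h' η hη, map_pow, h η hη, ← pow_mul]

theorem ActsAsPow.pow {m k : ℕ} {τ : F ≃ₐ[O] F} (h : ActsAsPow m k τ) (q : ℕ) :
    ActsAsPow m (k ^ q) (τ ^ q) := by
  induction q with
  | zero => intro η _; simp
  | succ q ih => rw [pow_succ, pow_succ]; exact ih.mul h

theorem ActsAsPow.mul_inv {m k l : ℕ} {τ τ' : F ≃ₐ[O] F} (h : ActsAsPow m (k * l) τ)
    (h' : ActsAsPow m k τ') : ActsAsPow m l (τ * τ'⁻¹) := fun η hη => by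
  obtain ⟨ξ, rfl⟩ := τ'.surjective η
  have hξ : ξ ^ m = 1 := by
    apply τ'.injective
    rw [map_pow, hη, map_one]
  rw [AlgEquiv.mul_apply, show τ'⁻¹ (τ' ξ) = ξ from τ'.symm_apply_apply ξ, h ξ hξ, h' ξ hξ,
    ← pow_mul]

/-- The automorphisms acting by powers of `q` on the `m`-th roots of unity act through powers of
one of them. -/
theorem exists_actsAsPow_generator (O F : Type*) [Field F] [CommRing O] [Algebra O F] {m q : ℕ}
    (hm : m ≠ 0) (hq : q.Coprime m) :
    ∃ τ₀ : F ≃ₐ[O] F, ∀ (u : ℕ) (τ : F ≃ₐ[O] F), ActsAsPow m (q ^ u) τ →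
      ∃ i, ActsAsPow m (q ^ u) (τ₀ ^ i) := by
  classical
  -- The generator is an automorphism realising the least positive exponent u. One exists because
  -- q^φ(m) ≡ 1 mod m, so the identity realises φ(m).
  have hex : ∃ u, 0 < u ∧ ∃ τ : F ≃ₐ[O] F, ActsAsPow m (q ^ u) τ := by
    refine ⟨m.totient, Nat.totient_pos.2 (Nat.pos_of_ne_zero hm), 1, fun η hη => ?_⟩
    have := pow_eq_pow_of_modEq (Nat.ModEq.pow_totient hq) hη
    rw [this, pow_one]; rfl
  obtain ⟨h0, τ₀, hτ₀⟩ := Nat.find_spec hex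
  refine ⟨τ₀, fun u τ hτ => ⟨u / Nat.find hex, ?_⟩⟩
  have hpow := hτ₀.pow (u / Nat.find hex)
  rw [← pow_mul] at hpow
  have hdiv := Nat.div_add_mod u (Nat.find hex)
  -- Dividing off a power of `τ₀` would realise the remainder as a smaller positive exponent.
  have hr : u % Nat.find hex = 0 := by
    by_contra hr
    refine Nat.find_min hex (Nat.mod_lt u h0) ⟨Nat.pos_of_ne_zero hr, _, ActsAsPow.mul_inv (τ := τ) ?_ hpow⟩
    rwa [← pow_add, hdiv]
  rw [hr, add_zero] at hdiv
  rwa [hdiv] at hpow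

/-- Extension of an automorphism of the splitting field of `x ^ m - 1` to the algebraic closure. -/
theorem exists_actsAsPow_of_rootsField {k : Type*} [Field k] [Algebra k F] [IsAlgClosure k F]
    [Algebra O k] [IsScalarTower O k F] {p n j : ℕ} (hm : pPrimePart p n ≠ 0)
    (τ : rootsField p n k ≃ₐ[k] rootsField p n k)
    (hτ : ∀ η : rootsField p n k, η ^ pPrimePart p n = 1 → τ η = η ^ j) :
    ∃ τ' : F ≃ₐ[O] F, ActsAsPow (pPrimePart p n) j τ' := by
  have := IsAlgClosure.isAlgClosed k (K := F)
  have := IsAlgClosure.normal k F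
  let f : rootsField p n k →ₐ[k] F := IsAlgClosed.lift
  let _ := f.toRingHom.toAlgebra
  have : IsScalarTower k (rootsField p n k) F := IsScalarTower.of_algebraMap_eq' f.comp_algebraMap.symm
  refine ⟨(τ.liftNormal F).restrictScalars O, fun η hη => ?_⟩
  -- The polynomial already splits in the embedded splitting field, so every m-th root of unity of
  -- `F` comes from there.
  obtain ⟨ξ, rfl⟩ : ∃ ξ, f ξ = η := by
    have hs := (Polynomial.SplittingField.splits
      (Polynomial.X ^ pPrimePart p n - 1 : Polynomial k))
    have hr := hs.roots_map f.toRingHom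
    have hmem : η ∈ (Polynomial.map f.toRingHom (Polynomial.map (algebraMap k (rootsField p n k))
        (Polynomial.X ^ pPrimePart p n - 1))).roots := by
      rw [Polynomial.mem_roots']
      simp only [Polynomial.map_sub, Polynomial.map_pow, Polynomial.map_X, Polynomial.map_one]
      exact ⟨Polynomial.X_pow_sub_C_ne_zero (Nat.pos_of_ne_zero hm) 1, by simp [hη]⟩
    rw [hr] at hmem
    obtain ⟨ξ, -, hξ⟩ := Multiset.mem_map.1 hmem
    exact ⟨ξ, hξ⟩
  have hξ : ξ ^ pPrimePart p n = 1 := by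
    have h1 : f (ξ ^ pPrimePart p n) = f 1 := by rw [map_pow, hη, map_one]
    exact f.toRingHom.injective h1
  refine (τ.liftNormal_commutes F ξ).trans ?_
  rw [hτ ξ hξ]
  exact map_pow f ξ j

end

end

/-! ### Proof of the theorem -/

theorem theorem1 (p : ℕ) [Fact p.Prime]
    -- a `p`-modular system `(K, O, k)` with `k = O / J(O)` perfect and `J(O) = p O`
    (O : Type u) [CommRing O] [IsDomain O] [IsDiscreteValuationRing O]
    [IsAdicComplete (IsLocalRing.maximalIdeal O) O]
    [CharP (IsLocalRing.ResidueField O) p] [PerfectField (IsLocalRing.ResidueField O)]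
    (hunram : IsLocalRing.maximalIdeal O = Ideal.span {(p : O)})
    (K : Type*) [Field K] [CharZero K] [Algebra O K] [IsFractionRing O K]
    -- an algebraic closure of `K`
    (Kbar : Type*) [Field Kbar] [CharZero Kbar] [Algebra K Kbar] [IsAlgClosure K Kbar]
    [Algebra O Kbar] [IsScalarTower O K Kbar]
    -- an algebraic closure of `k`, and the reduction map onto it from the integers of `Kbar`
    (kbar : Type*) [Field kbar] [Algebra (IsLocalRing.ResidueField O) kbar]
    [IsAlgClosure (IsLocalRing.ResidueField O) kbar]
    [Algebra O kbar] [IsScalarTower O (IsLocalRing.ResidueField O) kbar]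
    (π : integralClosure O Kbar →ₐ[O] kbar)
    -- the groups and the blocks
    (G : Type v₁) [Group G] [Finite G] (H : Type v₂) [Group H] [Finite H]
    (n : ℕ) [NeZero n] (hG : Nat.card G ∣ n) (hH : Nat.card H ∣ n)
    (b : MonoidAlgebra O G) (hb : IsBlockIdempotent b)
    (c : MonoidAlgebra O H) (hc : IsBlockIdempotent c)
    -- the virtual bimodule
    (X : VirtualBimod.{w} O hb.idem.Corner hc.idem.Corner)
    (hX : X.InducesVirtualMorita X.dual) :
    ∃ I : IBr p π b ≃ IBr p π c,
      ∀ σ ∈ galoisSubgroup p n (IsLocalRing.ResidueField O) Kbar, ∀ φ : IBr p π b,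
        ∃ ψ : IBr p π b,
          IsGaloisConj σ (φ : PRegular p G → Kbar) ψ ∧
          IsGaloisConj σ (I φ : PRegular p H → Kbar) (I ψ) := by
  have : IsAlgClosed Kbar := IsAlgClosure.isAlgClosed K
  have : IsAlgClosed kbar := IsAlgClosure.isAlgClosed (IsLocalRing.ResidueField O)
  have : CharP kbar p := charP_of_injective_algebraMap
    (algebraMap (IsLocalRing.ResidueField O) kbar).injective p
  obtain ⟨e, he⟩ := hX.exists_equiv_frobeniusTraces kbar p
  have hm : pPrimePart p n ≠ 0 := (Nat.ordCompl_pos p (NeZero.ne n)).ne'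
  -- The generator is fixed before `I`, because one bijection must serve all σ and the permutation
  -- argument treats one automorphism at a time.
  obtain ⟨τ₀, hτ₀⟩ := exists_actsAsPow_generator O kbar hm
    (Nat.coprime_ordCompl (Fact.out : p.Prime) (NeZero.ne n))
  obtain ⟨I, hI⟩ := exists_equiv_IBr (π := π) hb hc e he τ₀
  refine ⟨I, fun σ ⟨u, τ, hσ, hτ⟩ φ => ?_⟩
  obtain ⟨τ', hτ'⟩ := exists_actsAsPow_of_rootsField (F := kbar) (O := O) hm τ hτ
  -- σ and `τ₀ ^ i` raise p'-roots of unity to the same power of p. Brauer character values are sums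
  -- of such roots, so twisting by `τ₀ ^ i` realises σ for both groups.
  obtain ⟨i, hi⟩ := hτ₀ u τ' hτ'
  have hI' : ∀ (i : ℕ) φ, I (IBr.twistHom hb.idem (τ₀ ^ i) φ) =
      IBr.twistHom hc.idem (τ₀ ^ i) (I φ) := by
    intro i
    induction i with
    | zero => intro φ; simp
    | succ i ih =>
      intro φ
      rw [pow_succ', map_mul, map_mul, Equiv.Perm.mul_apply, Equiv.Perm.mul_apply, hI, ih]
  refine ⟨IBr.twistHom hb.idem (τ₀ ^ i) φ, IBr.isGaloisConj_twist hG hi hσ φ, ?_⟩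
  rw [hI']
  exact IBr.isGaloisConj_twist hH hi hσ (I φ)
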